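/- Let $H$ be a finite simple graph with $h$ vertices that is connected and contains exactly one cycle, and suppose that this cycle has even length $k$. Let $n, b \ge 0$ be integers with $$b+1 \le \frac{n}{200\,k\,(h-k+1)}.$$ Then Enforcer has a winning strategy in the strict $(1:b)$ Avoider--Enforcer $H$-game on the complete graph $K_n$. In this game the two players alternately claim previously unclaimed edges of $K_n$, with Avoider moving first, until all edges are claimed; Avoider claims exactly one edge per turn, and Enforcer claims exactly $b$ edges per turn, or all the unclaimed edges if fewer than $b$ of them are left. Avoider loses (and Enforcer wins) if at the end of the game the graph formed by the edges that Avoider has claimed contains a copy of $H$ as a (not necessarily induced) subgraph; otherwise Avoider wins. -/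

import Mathlib

/-- `H` is unicyclic: it is connected and contains exactly one cycle.
Cycles are counted as subgraphs, so that the different closed walks around the same cycle
(other starting points, other direction) are identified. -/
def IsUnicyclic {W : Type*} (H : SimpleGraph W) : Prop :=
  H.Connected ∧
    ∃! C : H.Subgraph, ∃ (v : W) (c : H.Walk v v), c.IsCycle ∧ c.toSubgraph = C

namespace AvoiderEnforcer

/-- A position of an Avoider–Enforcer game whose board consists of elements of `α`: the sets of
elements claimed so far by Avoider and by Enforcer. -/
structure Position (α : Type*) where
  avoider : Finset α
  enforcer : Finset α

section

variable {α : Type*} [DecidableEq α]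

/-- The elements of the board that no player has claimed yet. -/
def Position.free (board : Finset α) (p : Position α) : Finset α :=
  board \ (p.avoider ∪ p.enforcer)

/-- The position after Avoider claims `e`. -/
def Position.avoiderClaims (p : Position α) (e : α) : Position α :=
  ⟨insert e p.avoider, p.enforcer⟩

/-- The position after Enforcer claims all elements of `S`. -/
def Position.enforcerClaims (p : Position α) (S : Finset α) : Position α :=
  ⟨p.avoider, p.enforcer ∪ S⟩

/-- `S` is a legal move of Enforcer in the position `p` of the `(1 : b)` game: he claims exactly
`b` free elements, or all the free elements if fewer than `b` are left. -/
def IsEnforcerMove (board : Finset α) (b : ℕ) (p : Position α) (S : Finset α) : Prop :=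
  S ⊆ p.free board ∧ S.card = min b (p.free board).card

/-- The position reached from the start of the game after Avoider has made the moves in the list
(most recent move first) and Enforcer, moving second, has replied to each of them by `σ`.
A strategy `σ` of Enforcer assigns to the list of all moves that Avoider has made so far
the set that Enforcer claims next. -/
def position (σ : List α → Finset α) : List α → Position α
  | [] => ⟨∅, ∅⟩
  | e :: l => ((position σ l).avoiderClaims e).enforcerClaims (σ (e :: l))

/-- The list (most recent move first) is a sequence of legal moves of Avoider against `σ`: each
of the claimed elements was free when Avoider claimed it. -/
inductive IsPlay (board : Finset α) (σ : List α → Finset α) : List α → Prop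
  | nil : IsPlay board σ []
  | cons (e : α) (l : List α) (hl : IsPlay board σ l) (he : e ∈ (position σ l).free board) :
      IsPlay board σ (e :: l)

/-- `σ` is a winning strategy of Enforcer in the strict `(1 : b)` Avoider–Enforcer game in which
Avoider moves first and loses if the set of all elements that she has claimed at the end of the
game satisfies `losing`: the replies of `σ` are always legal moves, and every play against `σ`
that has exhausted the board is lost by Avoider. -/
def IsWinningStrategy (board : Finset α) (b : ℕ) (losing : Finset α → Prop)
    (σ : List α → Finset α) : Prop :=
  (∀ (e : α) (l : List α), IsPlay board σ (e :: l) →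
      IsEnforcerMove board b ((position σ l).avoiderClaims e) (σ (e :: l))) ∧
    ∀ l : List α, IsPlay board σ l → (position σ l).free board = ∅ →
      losing (position σ l).avoider

end

/-- Enforcer wins the (strict) `(1 : b)` Avoider–Enforcer `H`-game on `K_n`: the board is the edge
set of the complete graph on `n` vertices, Avoider moves first and loses if her graph contains a
copy of `H` at the end, and Enforcer has a winning strategy. -/
def EnforcerWinsGraphGame {W : Type*} (H : SimpleGraph W) (n b : ℕ) : Prop :=
  ∃ σ : List (Sym2 (Fin n)) → Finset (Sym2 (Fin n)),
    IsWinningStrategy (⊤ : SimpleGraph (Fin n)).edgeFinset b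
      (fun A => H.IsContained (SimpleGraph.fromEdgeSet (A : Set (Sym2 (Fin n))))) σ

end AvoiderEnforcer

/-! Let `H` have `h` vertices and cycle length `k`. As `(k - 1)(h - k) ≥ 0`, we have `h ≤ k(h - k +
1)`, so `n ≥ 200h(b + 1)`; only this bound is used below.

Fix disjoint vertex sets `X`, `Y` of sizes `100h(b + 1)` and `4h(b + 1)`. Enforcer spares the pairs
inside `X` while anything else is free, and answers an edge from `x ∈ X` to `Y` in the star of `x`
as long as possible. If Avoider collects `h|X| + b + 1` pairs inside `X`, these alone create more
than `b` simultaneous threats (`IsUnicyclic.exists_threats`), and she cannot evade them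
(`EnforcerWins.of_threats`). Otherwise, when only pairs inside `X` remain, she holds about `3h|X|`
edges or more between `X` and `Y`, at most `4h` of them at each `x` (`EnforcerWins.of_rows`).

This bipartite graph has a dense core of minimum degree at least `h`. Since `k - 2` is even, paths
of that length can join two vertices `x`, `x'` of `X`, and the pairs `zx`, `zx'` inside `X` then
close a `k`-cycle; the minimum degree leaves room for the trees of `H` attached to it. In this way
`IsUnicyclic.exists_triple` yields `(b + 1)(b + 3)` disjoint free triples of pairs, the first of
which completes `H` with either of the others.

Such triples win the endgame (`EnforcerWins.of_pieces`). Whenever Avoider touches one, a threat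
arises. The third pair is a spare: Enforcer, who must claim exactly `b` edges, may take it without
spoiling the other two. The spares last until there are more than `b` threats. -/

namespace AvoiderEnforcer

/-! ### Abstract endgames: threats and triples -/

section Game

variable {α : Type*} [DecidableEq α]

/-- Enforcer can force a win from the position `p`, with Avoider to move. -/
inductive EnforcerWins (board : Finset α) (b : ℕ) (losing : Finset α → Prop) :
    Position α → Prop
  | mk (p : Position α) (reply : α → Finset α) (h0 : p.free board = ∅ → losing p.avoider)
      (hm : ∀ e ∈ p.free board, IsEnforcerMove board b (p.avoiderClaims e) (reply e))
      (hw : ∀ e ∈ p.free board,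
        EnforcerWins board b losing ((p.avoiderClaims e).enforcerClaims (reply e))) :
      EnforcerWins board b losing p

/-- The position after Avoider's moves in the list when Enforcer answers by `reply`. -/
def replyPosition (reply : Position α → α → Finset α) : List α → Position α
  | [] => ⟨∅, ∅⟩
  | e :: l => ((replyPosition reply l).avoiderClaims e).enforcerClaims
      (reply (replyPosition reply l) e)

/-- The strategy that answers Avoider's last move by `reply`. -/
def replyStrategy (reply : Position α → α → Finset α) : List α → Finset α
  | [] => ∅
  | e :: l => reply (replyPosition reply l) e

theorem position_replyStrategy (reply : Position α → α → Finset α) (l : List α) :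
    position (replyStrategy reply) l = replyPosition reply l := by
  induction l with
  | nil => rfl
  | cons e l ih => simp only [position, replyPosition, replyStrategy, ih]

/-- Winning is defined on positions, whereas a strategy sees Avoider's moves. Choosing one good
reply for each winning position and each move determines the position from the history. -/
theorem EnforcerWins.exists_strategy {board : Finset α} {b : ℕ} {losing : Finset α → Prop}
    (hw : EnforcerWins board b losing ⟨∅, ∅⟩) :
    ∃ σ, IsWinningStrategy board b losing σ := by
  classical
  have key : ∀ (p : Position α) (e : α), ∃ S, EnforcerWins board b losing p →
      e ∈ p.free board → IsEnforcerMove board b (p.avoiderClaims e) S ∧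
        EnforcerWins board b losing ((p.avoiderClaims e).enforcerClaims S) := by
    intro p e
    by_cases hp : EnforcerWins board b losing p ∧ e ∈ p.free board
    · obtain ⟨⟨_, S, _, hm, hw⟩, he⟩ := hp
      exact ⟨S e, fun _ _ => ⟨hm e he, hw e he⟩⟩
    · exact ⟨∅, fun h1 h2 => absurd ⟨h1, h2⟩ hp⟩
  choose reply hreply using key
  have hpos : ∀ l, IsPlay board (replyStrategy reply) l →
      EnforcerWins board b losing (replyPosition reply l) := by
    intro l hl
    induction hl with
    | nil => exact hw
    | cons e l _ he ih =>
      rw [position_replyStrategy] at he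
      exact (hreply _ e ih he).2
  refine ⟨replyStrategy reply, ?_, ?_⟩
  · intro e l hl
    cases hl with
    | cons _ _ hl he =>
      rw [position_replyStrategy] at he ⊢
      exact (hreply _ e (hpos l hl) he).1
  · intro l hl hfree
    rw [position_replyStrategy] at hfree ⊢
    obtain ⟨_, _, h0, _, _⟩ := hpos l hl
    exact h0 hfree

theorem Position.free_next {board : Finset α} (p : Position α) (e : α) (S : Finset α) :
    ((p.avoiderClaims e).enforcerClaims S).free board = (p.free board).erase e \ S := by
  ext x
  simp only [Position.free, Position.avoiderClaims, Position.enforcerClaims, Finset.mem_sdiff,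
    Finset.mem_union, Finset.mem_insert, Finset.mem_erase]
  tauto

theorem Position.free_avoiderClaims {board : Finset α} (p : Position α) (e : α) :
    (p.avoiderClaims e).free board = (p.free board).erase e := by
  ext x
  simp only [Position.free, Position.avoiderClaims, Finset.mem_sdiff,
    Finset.mem_union, Finset.mem_insert, Finset.mem_erase]
  tauto

variable {board : Finset α} {b : ℕ} {losing : Finset α → Prop}

/-- A condition that Enforcer can maintain until the end of the game, where it makes Avoider
lose, is sufficient for his win. -/
theorem EnforcerWins.of_invariant (Inv : Position α → Prop)
    (h0 : ∀ p, Inv p → p.free board = ∅ → losing p.avoider)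
    (hs : ∀ p, Inv p → ∀ e ∈ p.free board, ∃ S ⊆ (p.free board).erase e,
      S.card = min b ((p.free board).erase e).card ∧
        (Inv ((p.avoiderClaims e).enforcerClaims S) ∨
          EnforcerWins board b losing ((p.avoiderClaims e).enforcerClaims S)))
    (p : Position α) (hp : Inv p) : EnforcerWins board b losing p := by
  induction hn : (p.free board).card using Nat.strong_induction_on generalizing p with
  | _ n ih =>
    choose! S hS hc hI using hs p hp
    refine ⟨p, S, h0 p hp, fun e he => ⟨?_, ?_⟩, fun e he => ?_⟩
    · rw [p.free_avoiderClaims]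
      exact hS e he
    · rw [p.free_avoiderClaims]
      exact hc e he
    rcases hI e he with hI | hI
    · refine ih _ ?_ _ hI rfl
      rw [← hn, p.free_next]
      exact (Finset.card_le_card Finset.sdiff_subset).trans_lt (Finset.card_erase_lt_of_mem he)
    · exact hI

/-- Enforcer can serve a chain of two sets of elements in order. -/
theorem exists_greedy {α : Type*} (b : ℕ) {F G K : Finset α} (hFG : F ⊆ G) (hGK : G ⊆ K) :
    ∃ S ⊆ K, S.card = min b K.card ∧ (S ⊆ F ∨ F ⊆ S) ∧ (S ⊆ G ∨ G ⊆ S) := by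
  rcases le_total b F.card with h1 | h1
  · obtain ⟨S, hS, hc⟩ := Finset.exists_subset_card_eq h1
    have := Finset.card_le_card (hFG.trans hGK)
    exact ⟨S, hS.trans (hFG.trans hGK), by omega, Or.inl hS, Or.inl (hS.trans hFG)⟩
  rcases le_total b G.card with h2 | h2
  · obtain ⟨S, hFS, hS, hc⟩ := Finset.exists_subsuperset_card_eq hFG h1 h2
    have := Finset.card_le_card hGK
    exact ⟨S, hS.trans hGK, by omega, Or.inr hFS, Or.inl hS⟩
  · have := Finset.card_le_card hGK
    obtain ⟨S, hGS, hS, hc⟩ := Finset.exists_subsuperset_card_eq hGK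
      (n := min b K.card) (by omega) (by omega)
    exact ⟨S, hS, hc, Or.inr (hFG.trans hGS), Or.inr hGS⟩

theorem EnforcerWins.of_losing (hmono : Monotone losing) (p : Position α)
    (hp : losing p.avoider) : EnforcerWins board b losing p := by
  refine of_invariant (fun p => losing p.avoider) (fun p hp _ => hp) ?_ p hp
  intro p hp e he
  obtain ⟨S, hS, hc, -⟩ := exists_greedy b (Finset.Subset.refl ((p.free board).erase e))
    (Finset.Subset.refl _)
  exact ⟨S, hS, hc, Or.inl (hmono (Finset.subset_insert _ _) hp)⟩

/-- Enforcer takes non-threats first. Either these suffice and no threat is lost, or only threats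
remain; since there were more than `b`, some survive. -/
theorem exists_threat_reply {F Θ : Finset α} (hc : b < Θ.card) :
    ∃ S ⊆ F, S.card = min b F.card ∧ (Θ \ S).Nonempty ∧ (b < (Θ \ S).card ∨ F \ S ⊆ Θ \ S) := by
  obtain ⟨S, hS, hcS, hSF, -⟩ := exists_greedy b
    (Finset.sdiff_subset (s := F) (t := Θ)) (Finset.Subset.refl _)
  refine ⟨S, hS, hcS, ?_, ?_⟩
  · have := Finset.le_card_sdiff S Θ
    exact Finset.card_pos.1 (by omega)
  · rcases hSF with h | h
    · left
      rwa [Finset.sdiff_eq_self_of_disjoint]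
      exact Finset.disjoint_right.2 fun f hf => (Finset.mem_sdiff.1 (h hf)).2
    · right
      intro f hf
      obtain ⟨h1, h2⟩ := Finset.mem_sdiff.1 hf
      refine Finset.mem_sdiff.2 ⟨?_, h2⟩
      by_contra h3
      exact h2 (h (Finset.mem_sdiff.2 ⟨h1, h3⟩))

/-- Enforcer wins if more than `b` free elements, or all of at least one free elements, are
threats: each of them would complete a losing set of Avoider. -/
theorem EnforcerWins.of_threats (hmono : Monotone losing) (p : Position α) (Θ : Finset α)
    (hΘ : Θ ⊆ p.free board) (hlose : ∀ f ∈ Θ, losing (insert f p.avoider)) (hne : Θ.Nonempty)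
    (hcard : b < Θ.card ∨ p.free board ⊆ Θ) :
    EnforcerWins board b losing p := by
  refine of_invariant (fun p => losing p.avoider ∨ ∃ Θ : Finset α, Θ ⊆ p.free board ∧
    (∀ f ∈ Θ, losing (insert f p.avoider)) ∧ Θ.Nonempty ∧ (b < Θ.card ∨ p.free board ⊆ Θ))
    ?_ ?_ p (Or.inr ⟨Θ, hΘ, hlose, hne, hcard⟩)
  · rintro p (hp | ⟨Θ, hΘ, -, ⟨f, hf⟩, -⟩) h0
    · exact hp
    · simpa [h0] using hΘ hf
  · intro p hp e he
    by_cases hL : losing (insert e p.avoider)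
    · obtain ⟨S, hS, hc, -⟩ := exists_greedy b (Finset.Subset.refl ((p.free board).erase e))
        (Finset.Subset.refl _)
      exact ⟨S, hS, hc, Or.inl (Or.inl hL)⟩
    rcases hp with hp | ⟨Θ, hΘ, hl, hne, hc⟩
    · exact absurd (hmono (Finset.subset_insert _ _) hp) hL
    have heΘ : e ∉ Θ := fun h => hL (hl e h)
    -- If all free elements were threats, the move `e` would have lost.
    have hc : b < Θ.card := hc.resolve_right fun h => heΘ (h he)
    have hΘ' : Θ ⊆ (p.free board).erase e := fun f hf =>
      Finset.mem_erase.2 ⟨fun h => heΘ (h ▸ hf), hΘ hf⟩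
    obtain ⟨S, hS, hcS, hne, hor⟩ := exists_threat_reply (F := (p.free board).erase e) hc
    refine ⟨S, hS, hcS, Or.inl (Or.inr ⟨Θ \ S, ?_, ?_, hne, ?_⟩)⟩
    · rw [p.free_next]
      exact Finset.sdiff_subset_sdiff hΘ' (Finset.Subset.refl _)
    · exact fun f hf => hmono (Finset.insert_subset_insert _ (Finset.subset_insert _ _))
        (hl f (Finset.mem_sdiff.1 hf).1)
    · rwa [p.free_next]

/-- The elements of the pieces: the first two elements of the pieces in `J` and
the third element of the pieces in `R`. -/
def pieceElements {ι : Type*} (x : ι → Fin 3 → α) (J R : Finset ι) : Finset α :=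
  J.image (fun j => x j 0) ∪ J.image (fun j => x j 1) ∪ R.image (fun j => x j 2)

theorem mem_pieceElements {ι : Type*} {x : ι → Fin 3 → α} {J R : Finset ι} {f : α} :
    f ∈ pieceElements x J R ↔
      ∃ j, (j ∈ J ∧ (f = x j 0 ∨ f = x j 1)) ∨ (j ∈ R ∧ f = x j 2) := by
  simp only [pieceElements, Finset.mem_union, Finset.mem_image]
  constructor
  · rintro ((⟨j, hj, rfl⟩ | ⟨j, hj, rfl⟩) | ⟨j, hj, rfl⟩) <;> exact ⟨j, by tauto⟩
  · rintro ⟨j, ⟨hj, rfl | rfl⟩ | ⟨hj, rfl⟩⟩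
    · exact Or.inl (Or.inl ⟨j, hj, rfl⟩)
    · exact Or.inl (Or.inr ⟨j, hj, rfl⟩)
    · exact Or.inr ⟨j, hj, rfl⟩

/-- Enforcer's answer when the free elements `F` contain collected threats `Θ` and pieces:
he takes elements outside of these as long as possible, then third elements of pieces. -/
theorem exists_piece_reply {ι : Type*} [DecidableEq ι] {x : ι → Fin 3 → α}
    (hx : Function.Injective fun a : ι × Fin 3 => x a.1 a.2) {F Θ : Finset α} {J R : Finset ι}
    (hP : pieceElements x J R ⊆ F) (hd : Disjoint Θ (pieceElements x J R))
    (hb : Θ.card ≤ b) (hN : (b + 2) * (b + 1) + (b + 1) ≤ R.card + (b + 2) * Θ.card) :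
    ∃ S ⊆ F, S.card = min b F.card ∧ ∃ R' ⊆ R, Disjoint Θ S ∧
      Disjoint S (pieceElements x J R') ∧
      (b + 2) * (b + 1) ≤ R'.card + (b + 2) * Θ.card ∧
      (((F \ S) \ (Θ ∪ pieceElements x J R')).Nonempty →
        (b + 2) * (b + 1) + (b + 1) ≤ R'.card + (b + 2) * Θ.card) := by
  set rest := F \ (Θ ∪ pieceElements x J R) with hrest
  have hrF : rest ⊆ F := Finset.sdiff_subset
  rcases le_total b rest.card with h | h
  · obtain ⟨S, hS, hc⟩ := Finset.exists_subset_card_eq h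
    have hF := Finset.card_le_card (hS.trans hrF)
    have hdis : ∀ f ∈ S, f ∉ Θ ∧ f ∉ pieceElements x J R := fun f hf => by
      have := (Finset.mem_sdiff.1 (hS hf)).2
      simpa [not_or] using this
    exact ⟨S, hS.trans hrF, by omega, R, Finset.Subset.refl _,
      Finset.disjoint_right.2 fun f hf => (hdis f hf).1,
      Finset.disjoint_left.2 fun f hf => (hdis f hf).2, by omega, fun _ => hN⟩
  -- With at most `b` threats, the potential leaves at least `2b + 3` third elements to spend.
  · have hR : b ≤ R.card := by nlinarith
    obtain ⟨R0, hR0, hc0⟩ := Finset.exists_subset_card_eq (n := b - rest.card)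
      (show b - rest.card ≤ R.card by omega)
    have hx2 : Function.Injective fun j => x j 2 := fun i j hij => by
      have := @hx (i, 2) (j, 2) hij
      simpa using this
    have hmem : ∀ f ∈ R0.image (fun j => x j 2), f ∈ pieceElements x J R := by
      intro f hf
      obtain ⟨j, hj, rfl⟩ := Finset.mem_image.1 hf
      exact mem_pieceElements.2 ⟨j, Or.inr ⟨hR0 hj, rfl⟩⟩
    have hdisj : Disjoint rest (R0.image fun j => x j 2) :=
      Finset.disjoint_right.2 fun f hf hf' =>
        (Finset.mem_sdiff.1 hf').2 (Finset.mem_union_right _ (hmem f hf))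
    have hSF : rest ∪ R0.image (fun j => x j 2) ⊆ F :=
      Finset.union_subset hrF fun f hf => hP (hmem f hf)
    have hcS : (rest ∪ R0.image fun j => x j 2).card = b := by
      rw [Finset.card_union_of_disjoint hdisj, Finset.card_image_of_injective _ hx2]
      omega
    have hF := Finset.card_le_card hSF
    have hcR : (R \ R0).card = R.card - R0.card := Finset.card_sdiff_of_subset hR0
    refine ⟨rest ∪ R0.image fun j => x j 2, hSF, by omega, R \ R0, Finset.sdiff_subset, ?_, ?_,
      by omega, ?_⟩
    · refine Finset.disjoint_right.2 fun f hf hf' => ?_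
      rcases Finset.mem_union.1 hf with hf | hf
      · exact (Finset.mem_sdiff.1 hf).2 (Finset.mem_union_left _ hf')
      · exact Finset.disjoint_left.1 hd hf' (hmem f hf)
    · refine Finset.disjoint_left.2 fun f hf hf' => ?_
      obtain ⟨j, hj⟩ := mem_pieceElements.1 hf'
      rcases Finset.mem_union.1 hf with hf | hf
      · refine (Finset.mem_sdiff.1 hf).2 (Finset.mem_union_right _ (mem_pieceElements.2 ⟨j, ?_⟩))
        exact hj.imp id fun h => ⟨(Finset.mem_sdiff.1 h.1).1, h.2⟩
      · obtain ⟨i, hi, rfl⟩ := Finset.mem_image.1 hf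
        rcases hj with ⟨-, hj | hj⟩ | ⟨hj, hij⟩
        · simpa using @hx (i, 2) (j, 0) hj
        · simpa using @hx (i, 2) (j, 1) hj
        · exact (Finset.mem_sdiff.1 hj).2 (hx2 hij ▸ hi)
    · rintro ⟨f, hf⟩
      simp only [hrest, Finset.mem_sdiff, Finset.mem_union, mem_pieceElements, Finset.mem_image]
        at hf
      exfalso
      obtain ⟨⟨hfF, h1⟩, h2⟩ := hf
      refine h1 (Or.inl ⟨hfF, fun h3 => ?_⟩)
      rcases h3 with h3 | ⟨j, h3 | h3⟩
      · exact h2 (Or.inl h3)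
      · exact h2 (Or.inr ⟨j, Or.inl h3⟩)
      · by_cases hj : j ∈ R0
        · exact h1 (Or.inr ⟨j, hj, h3.2.symm⟩)
        · exact h2 (Or.inr ⟨j, Or.inr ⟨⟨h3.1, hj⟩, h3.2⟩⟩)

/-- Enforcer wins if there are many disjoint free triples in which Avoider would lose by claiming
the first element and one of the other two. -/
theorem EnforcerWins.of_pieces (hmono : Monotone losing) (p : Position α) {ι : Type*}
    [Fintype ι] (x : ι → Fin 3 → α)
    (hx : Function.Injective fun a : ι × Fin 3 => x a.1 a.2)
    (hfree : ∀ j i, x j i ∈ p.free board)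
    (h1 : ∀ j, losing (insert (x j 0) (insert (x j 1) p.avoider)))
    (h2 : ∀ j, losing (insert (x j 0) (insert (x j 2) p.avoider)))
    (hcard : (b + 1) * (b + 3) ≤ Fintype.card ι) :
    EnforcerWins board b losing p := by
  classical
  -- `Θ` collects threats, `J` the pieces whose first two elements are kept free, and `R` those
  -- whose third is kept as well. The potential is `|R| + (b + 2)|Θ|`. A move of Avoider in a piece
  -- raises it by at least `b + 1`, and a reply lowers it by at most `b`. While other elements are
  -- free, Avoider may move without touching a piece, so the higher bound is demanded; it survives
  -- because a reply that leaves such elements has spent no third element.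
  refine of_invariant (fun p => (∀ j, losing (insert (x j 0) (insert (x j 1) p.avoider))) ∧
    (∀ j, losing (insert (x j 0) (insert (x j 2) p.avoider))) ∧
    ∃ (Θ : Finset α) (J R : Finset ι), Θ ⊆ p.free board ∧
      (∀ f ∈ Θ, losing (insert f p.avoider)) ∧ R ⊆ J ∧ pieceElements x J R ⊆ p.free board ∧
      Disjoint Θ (pieceElements x J R) ∧ (b + 2) * (b + 1) ≤ R.card + (b + 2) * Θ.card ∧
      ((p.free board \ (Θ ∪ pieceElements x J R)).Nonempty →
        (b + 2) * (b + 1) + (b + 1) ≤ R.card + (b + 2) * Θ.card)) ?_ ?_ p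
    ⟨h1, h2, ∅, Finset.univ, Finset.univ, by simp, by simp, Finset.Subset.refl _, ?_, by simp,
      ?_, fun _ => ?_⟩
  · rintro p ⟨-, -, Θ, J, R, hΘ, -, -, hP, -, hN, -⟩ h0
    -- The potential is positive, so a threat or a third element is still free.
    exfalso
    rw [h0, Finset.subset_empty] at hΘ hP
    have : R = ∅ := Finset.eq_empty_of_forall_notMem fun j hj => by
      have : x j 2 ∈ pieceElements x J R := mem_pieceElements.2 ⟨j, Or.inr ⟨hj, rfl⟩⟩
      simp [hP] at this
    simp [hΘ, this] at hN
  · rintro p ⟨h1, h2, Θ, J, R, hΘ, hl, hRJ, hP, hd, hN, hN'⟩ e he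
    have m1 := fun j => hmono (Finset.insert_subset_insert (x j 0) (Finset.insert_subset_insert
      (x j 1) (Finset.subset_insert e p.avoider))) (h1 j)
    have m2 := fun j => hmono (Finset.insert_subset_insert (x j 0) (Finset.insert_subset_insert
      (x j 2) (Finset.subset_insert e p.avoider))) (h2 j)
    by_cases hL : losing (insert e p.avoider)
    · obtain ⟨S, hS, hc, -⟩ := exists_greedy b (Finset.Subset.refl ((p.free board).erase e))
        (Finset.Subset.refl _)
      exact ⟨S, hS, hc, Or.inr (of_losing hmono _ hL)⟩
    have heΘ : e ∉ Θ := fun h => hL (hl e h)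
    have hl' : ∀ f ∈ Θ, losing (insert f (insert e p.avoider)) := fun f hf =>
      hmono (Finset.insert_subset_insert _ (Finset.subset_insert _ _)) (hl f hf)
    -- the structure that is left after Avoider's move
    obtain ⟨Θ', J', R', hΘ', hl'', hRJ', hP', hd', hN''⟩ : ∃ (Θ' : Finset α) (J' R' : Finset ι),
        Θ' ⊆ (p.free board).erase e ∧ (∀ f ∈ Θ', losing (insert f (insert e p.avoider))) ∧
        R' ⊆ J' ∧ pieceElements x J' R' ⊆ (p.free board).erase e ∧
        Disjoint Θ' (pieceElements x J' R') ∧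
        (b + 2) * (b + 1) + (b + 1) ≤ R'.card + (b + 2) * Θ'.card := by
      by_cases heP : e ∈ pieceElements x J R
      · obtain ⟨j, hj⟩ := mem_pieceElements.1 heP
        have hjJ : j ∈ J := hj.elim (fun h => h.1) (fun h => hRJ h.1)
        have hx' : ∀ i i' : ι, ∀ a a' : Fin 3, x i a = x i' a' → i = i' ∧ a = a' :=
          fun i i' a a' h => by simpa using @hx (i, a) (i', a') h
        obtain ⟨t, a, ht, htP, hte, htl⟩ : ∃ t a, t = x j a ∧ t ∈ pieceElements x J R ∧ t ≠ e ∧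
            losing (insert t (insert e p.avoider)) := by
          rcases hj with ⟨-, hj | hj⟩ | ⟨-, hj⟩
          · refine ⟨x j 1, 1, rfl, mem_pieceElements.2 ⟨j, Or.inl ⟨hjJ, Or.inr rfl⟩⟩, ?_, ?_⟩
            · rintro h
              simpa using hx' _ _ _ _ (h.trans hj)
            · rw [hj, Finset.insert_comm]
              exact h1 j
          · refine ⟨x j 0, 0, rfl, mem_pieceElements.2 ⟨j, Or.inl ⟨hjJ, Or.inl rfl⟩⟩, ?_, ?_⟩
            · rintro h
              simpa using hx' _ _ _ _ (h.trans hj)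
            · rw [hj]
              exact h1 j
          · refine ⟨x j 0, 0, rfl, mem_pieceElements.2 ⟨j, Or.inl ⟨hjJ, Or.inl rfl⟩⟩, ?_, ?_⟩
            · rintro h
              simpa using hx' _ _ _ _ (h.trans hj)
            · rw [hj]
              exact h2 j
        have htΘ : t ∉ Θ := Finset.disjoint_right.1 hd htP
        have hej : ∃ c, e = x j c := by
          rcases hj with ⟨-, hj | hj⟩ | ⟨-, hj⟩ <;> exact ⟨_, hj⟩
        have hsub : ∀ f ∈ pieceElements x (J.erase j) (R.erase j),
            f ∈ pieceElements x J R ∧ ∃ i c, i ≠ j ∧ f = x i c := by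
          intro f hf
          obtain ⟨i, hi⟩ := mem_pieceElements.1 hf
          rcases hi with ⟨hi, hif⟩ | ⟨hi, hif⟩
          · refine ⟨mem_pieceElements.2 ⟨i, Or.inl ⟨Finset.mem_of_mem_erase hi, hif⟩⟩, i, ?_⟩
            rcases hif with hif | hif <;> exact ⟨_, Finset.ne_of_mem_erase hi, hif⟩
          · exact ⟨mem_pieceElements.2 ⟨i, Or.inr ⟨Finset.mem_of_mem_erase hi, hif⟩⟩, i, _,
              Finset.ne_of_mem_erase hi, hif⟩
        refine ⟨insert t Θ, J.erase j, R.erase j, ?_, ?_, Finset.erase_subset_erase _ hRJ,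
          ?_, ?_, ?_⟩
        · refine Finset.insert_subset (Finset.mem_erase.2 ⟨hte, hP htP⟩) fun f hf =>
            Finset.mem_erase.2 ⟨fun h => heΘ (h ▸ hf), hΘ hf⟩
        · intro f hf
          rcases Finset.mem_insert.1 hf with rfl | hf
          · exact htl
          · exact hl' f hf
        · intro f hf
          obtain ⟨hf1, i, c, hij, rfl⟩ := hsub f hf
          obtain ⟨c', rfl⟩ := hej
          exact Finset.mem_erase.2 ⟨fun h => hij (hx' _ _ _ _ h).1, hP hf1⟩
        · refine Finset.disjoint_right.2 fun f hf hf' => ?_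
          obtain ⟨hf1, i, c, hij, rfl⟩ := hsub f hf
          rcases Finset.mem_insert.1 hf' with h | h
          · exact hij (hx' _ _ _ _ (h.trans ht)).1
          · exact Finset.disjoint_left.1 hd h hf1
        · rw [Finset.card_insert_of_notMem htΘ]
          have := Finset.pred_card_le_card_erase (s := R) (a := j)
          nlinarith [show R.card ≤ (R.erase j).card + 1 by omega]
      · refine ⟨Θ, J, R, fun f hf => Finset.mem_erase.2 ⟨fun h => heΘ (h ▸ hf), hΘ hf⟩, hl', hRJ,
          fun f hf => Finset.mem_erase.2 ⟨fun h => heP (h ▸ hf), hP hf⟩, hd, hN' ⟨e, ?_⟩⟩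
        simp [he, heΘ, heP]
    by_cases hb' : b < Θ'.card
    · obtain ⟨S, hS, hc, hne, hor⟩ := exists_threat_reply (F := (p.free board).erase e) hb'
      refine ⟨S, hS, hc, Or.inr (of_threats hmono _ (Θ' \ S) ?_ ?_ hne ?_)⟩
      · rw [p.free_next]
        exact Finset.sdiff_subset_sdiff hΘ' (Finset.Subset.refl _)
      · exact fun f hf => hl'' f (Finset.mem_sdiff.1 hf).1
      · rwa [p.free_next]
    obtain ⟨S, hS, hc, R'', hR'', hdS, hdS', hM, hM'⟩ :=
      exists_piece_reply hx hP' hd' (not_lt.1 hb') hN''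
    have hsub : pieceElements x J' R'' ⊆ pieceElements x J' R' :=
      Finset.union_subset_union (Finset.Subset.refl _) (Finset.image_subset_image hR'')
    refine ⟨S, hS, hc, Or.inl ⟨m1, m2, Θ', J', R'', ?_, hl'', hR''.trans hRJ', ?_, ?_, hM, ?_⟩⟩
    · rw [p.free_next]
      exact Finset.subset_sdiff.2 ⟨hΘ', hdS⟩
    · rw [p.free_next]
      exact Finset.subset_sdiff.2 ⟨hsub.trans hP', hdS'.symm⟩
    · exact hd'.mono_right hsub
    · rwa [p.free_next]
  · intro f hf
    obtain ⟨j, hj⟩ := mem_pieceElements.1 hf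
    rcases hj with ⟨-, rfl | rfl⟩ | ⟨-, rfl⟩ <;> exact hfree _ _
  · simp only [Finset.card_univ, Finset.card_empty]
    nlinarith
  · simp only [Finset.card_univ, Finset.card_empty]
    nlinarith

end Game

end AvoiderEnforcer

namespace AvoiderEnforcer

/-! ### Protecting a set while balancing the rows -/

section Rows

variable {α : Type*} [DecidableEq α] {board : Finset α} {b : ℕ} {losing : Finset α → Prop}

theorem card_insert_inter {A X : Finset α} {e : α} (he : e ∉ A) :
    (insert e A ∩ X).card = (A ∩ X).card + if e ∈ X then 1 else 0 := by
  split_ifs with h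
  · rw [Finset.insert_inter_of_mem h, Finset.card_insert_of_notMem (by simp [he])]
  · rw [Finset.insert_inter_of_notMem h, add_zero]

/-- What Enforcer maintains while he protects the set `Sp` and answers in the rows:
he claims at least `b` elements of a row for each element of it that Avoider claims, and
only boundedly many more. -/
structure RowInvariant {ι : Type*} [Fintype ι] (board : Finset α) (b D : ℕ)
    (row : ι → Finset α) (Sp : Finset α) (p : Position α) : Prop where
  avoider_subset : p.avoider ⊆ board
  disjoint : Disjoint p.avoider p.enforcer
  avoider_row : ∀ i, (p.avoider ∩ row i).card ≤ D
  enforcer_row : ∀ i, b * (p.avoider ∩ row i).card ≤ (p.enforcer ∩ row i).card ∨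
    row i ⊆ p.avoider ∪ p.enforcer
  enforcer_rows : (p.enforcer ∩ Finset.univ.biUnion row).card ≤
      b * ((p.avoider ∩ Finset.univ.biUnion row).card + (p.avoider ∩ Sp).card) ∨
    board \ (Sp ∪ Finset.univ.biUnion row) ⊆ p.avoider ∪ p.enforcer ∧
      (p.enforcer ∩ Finset.univ.biUnion row).card ≤
        b * ((p.avoider ∩ Finset.univ.biUnion row).card + (p.avoider ∩ Sp).card + 1)

variable {ι : Type*} [Fintype ι] {row : ι → Finset α} {Sp : Finset α} {D : ℕ}

/-- When everything outside of `Sp` has been claimed, Avoider has many elements of the rows. -/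
theorem RowInvariant.card_le {p : Position α} (hI : RowInvariant board b D row Sp p)
    (hrow : ∀ i, row i ⊆ board) (hdisj : ∀ i j, i ≠ j → Disjoint (row i) (row j))
    (hsp : ∀ i, Disjoint (row i) Sp) (hcard : ∀ i, (row i).card = D * (b + 1)) {s : ℕ}
    (hs : (p.avoider ∩ Sp).card ≤ s) (hfree : p.free board ⊆ Sp) :
    D * Fintype.card ι ≤ ∑ i, (p.avoider ∩ row i).card + s + 1 := by
  classical
  have hsum : (p.avoider ∩ Finset.univ.biUnion row).card = ∑ i, (p.avoider ∩ row i).card := by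
    rw [Finset.inter_biUnion, Finset.card_biUnion]
    exact fun i _ j _ hij => (hdisj i j hij).mono Finset.inter_subset_right
      Finset.inter_subset_right
  have hRc : (Finset.univ.biUnion row).card = Fintype.card ι * (D * (b + 1)) := by
    rw [Finset.card_biUnion (fun i _ j _ hij => hdisj i j hij)]
    simp [hcard]
  have hR : Finset.univ.biUnion row ⊆
      (p.avoider ∩ Finset.univ.biUnion row) ∪ (p.enforcer ∩ Finset.univ.biUnion row) := by
    intro f hf
    obtain ⟨i, -, hi⟩ := Finset.mem_biUnion.1 hf
    rw [← Finset.union_inter_distrib_right]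
    refine Finset.mem_inter.2 ⟨?_, hf⟩
    by_contra h
    exact Finset.disjoint_left.1 (hsp i) hi (hfree (Finset.mem_sdiff.2 ⟨hrow i hi, h⟩))
  have h1 := (Finset.card_le_card hR).trans (Finset.card_union_le _ _)
  have h2 : (p.enforcer ∩ Finset.univ.biUnion row).card ≤
      b * ((p.avoider ∩ Finset.univ.biUnion row).card + s + 1) := by
    rcases hI.enforcer_rows with h | ⟨-, h⟩
    · exact h.trans (Nat.mul_le_mul_left _ (by omega))
    · exact h.trans (Nat.mul_le_mul_left _ (by omega))
  rw [hRc] at h1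
  rw [← hsum]
  -- If Avoider has `a` elements of the rows, Enforcer has at most `b(a + s + 1)`, and together they
  -- have all `D(b + 1)|ι|`; divide by `b + 1`.
  refine Nat.le_of_mul_le_mul_left (c := b + 1) ?_ (by omega)
  nlinarith

/-- The invariant survives a round in which Enforcer prefers the row, or else the part outside
of the rows, where Avoider has moved. -/
theorem RowInvariant.next {p : Position α} (hI : RowInvariant board b D row Sp p)
    (hrow : ∀ i, row i ⊆ board) (hcard : ∀ i, (row i).card = D * (b + 1)) {e : α} (he : e ∈ p.free board) {S : Finset α}
    (hS : S ⊆ (p.free board).erase e) (hSc : S.card = min b ((p.free board).erase e).card)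
    (hSrow : ∀ i, e ∈ row i → S ⊆ (p.free board).erase e ∩ row i ∨
      (p.free board).erase e ∩ row i ⊆ S)
    (hSrest : e ∈ board \ (Sp ∪ Finset.univ.biUnion row) →
      S ⊆ (p.free board).erase e ∩ (board \ (Sp ∪ Finset.univ.biUnion row)) ∨
      (p.free board).erase e ∩ (board \ (Sp ∪ Finset.univ.biUnion row)) ⊆ S) :
    RowInvariant board b D row Sp ((p.avoiderClaims e).enforcerClaims S) := by
  classical
  obtain ⟨heb, hep⟩ := Finset.mem_sdiff.1 he
  rw [Finset.mem_union, not_or] at hep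
  obtain ⟨heA, heE⟩ := hep
  have hSA : ∀ f ∈ S, f ≠ e ∧ f ∉ p.avoider ∧ f ∉ p.enforcer := by
    intro f hf
    obtain ⟨h1, h2⟩ := Finset.mem_erase.1 (hS hf)
    have := (Finset.mem_sdiff.1 h2).2
    rw [Finset.mem_union, not_or] at this
    exact ⟨h1, this⟩
  have hSb : S.card ≤ b := by omega
  have hcl : ∀ {X : Finset α}, X ⊆ board → (p.free board).erase e ∩ X ⊆ S →
      X ⊆ insert e p.avoider ∪ (p.enforcer ∪ S) := by
    intro X hX h f hf
    by_contra hc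
    simp only [Finset.mem_union, Finset.mem_insert, not_or] at hc
    refine hc.2.2 (h (Finset.mem_inter.2 ⟨Finset.mem_erase.2 ⟨hc.1.1, Finset.mem_sdiff.2
      ⟨hX hf, ?_⟩⟩, hf⟩))
    simp [hc.1.2, hc.2.1]
  have hmonoE : ∀ X : Finset α, (p.enforcer ∩ X).card ≤ ((p.enforcer ∪ S) ∩ X).card := fun X =>
    Finset.card_le_card (Finset.inter_subset_inter_right Finset.subset_union_left)
  have hmono : p.avoider ∪ p.enforcer ⊆ insert e p.avoider ∪ (p.enforcer ∪ S) :=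
    Finset.union_subset_union (Finset.subset_insert _ _) Finset.subset_union_left
  have hpre : ∀ i, e ∈ row i → b * (p.avoider ∩ row i).card ≤ (p.enforcer ∩ row i).card := by
    intro i hi
    refine (hI.enforcer_row i).resolve_right fun h => ?_
    rcases Finset.mem_union.1 (h hi) with h | h
    · exact heA h
    · exact heE h
  have hadd : ∀ X : Finset α, ((p.enforcer ∪ S) ∩ X).card ≤
      (p.enforcer ∩ X).card + (S ∩ X).card := fun X => by
    rw [Finset.union_inter_distrib_right]
    exact Finset.card_union_le _ _
  refine ⟨?_, ?_, fun i => ?_, fun i => ?_, ?_⟩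
  · exact Finset.insert_subset heb hI.avoider_subset
  · simp only [Position.avoiderClaims, Position.enforcerClaims, Finset.disjoint_left,
      Finset.mem_insert, Finset.mem_union, not_or]
    rintro f (rfl | hf)
    · exact ⟨heE, fun h => (hSA f h).1 rfl⟩
    · exact ⟨Finset.disjoint_left.1 hI.disjoint hf, fun h => (hSA f h).2.1 hf⟩
  · change (insert e p.avoider ∩ row i).card ≤ D
    rw [card_insert_inter heA]
    split_ifs with h
    -- If Avoider had `a` elements of this row, Enforcer had at least `b * a`, and `e` was free
    -- besides; hence `a(b + 1) < D(b + 1)`.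
    · have h1 := hpre i h
      have h2 : insert e ((p.avoider ∩ row i) ∪ (p.enforcer ∩ row i)) ⊆ row i :=
        Finset.insert_subset h (Finset.union_subset Finset.inter_subset_right
          Finset.inter_subset_right)
      have h3 := Finset.card_le_card h2
      rw [Finset.card_insert_of_notMem (by simp [heA, heE]), Finset.card_union_of_disjoint
        (hI.disjoint.mono Finset.inter_subset_left Finset.inter_subset_left), hcard] at h3
      by_contra h4
      have : D ≤ (p.avoider ∩ row i).card := by omega
      nlinarith
    · simpa using hI.avoider_row i
  · change b * (insert e p.avoider ∩ row i).card ≤ ((p.enforcer ∪ S) ∩ row i).card ∨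
      row i ⊆ insert e p.avoider ∪ (p.enforcer ∪ S)
    rw [card_insert_inter heA]
    split_ifs with h
    · have hfull : (p.free board).erase e ∩ row i ⊆ S →
          row i ⊆ insert e p.avoider ∪ (p.enforcer ∪ S) := hcl (hrow i)
      rcases hSrow i h with hs | hs
      · rcases le_or_gt b ((p.free board).erase e).card with hb | hb
        · left
          have h1 : S ∩ row i = S :=
            Finset.inter_eq_left.2 (hs.trans Finset.inter_subset_right)
          have h2 : Disjoint (p.enforcer ∩ row i) S :=
            Finset.disjoint_right.2 fun f hf hf' => (hSA f hf).2.2 (Finset.mem_inter.1 hf').1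
          rw [Finset.union_inter_distrib_right, h1, Finset.card_union_of_disjoint h2, hSc,
            min_eq_left hb]
          have := hpre i h
          nlinarith
        · right
          have : S = (p.free board).erase e := Finset.eq_of_subset_of_card_le hS (by omega)
          exact hfull (this ▸ Finset.inter_subset_left)
      · exact Or.inr (hfull hs)
    · exact (hI.enforcer_row i).imp (fun h => h.trans (hmonoE _)) fun h => h.trans hmono
  · change ((p.enforcer ∪ S) ∩ _).card ≤
      b * ((insert e p.avoider ∩ _).card + (insert e p.avoider ∩ Sp).card) ∨
      _ ⊆ insert e p.avoider ∪ (p.enforcer ∪ S) ∧ ((p.enforcer ∪ S) ∩ _).card ≤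
      b * ((insert e p.avoider ∩ _).card + (insert e p.avoider ∩ Sp).card + 1)
    simp only [card_insert_inter heA]
    have h1 := hadd (Finset.univ.biUnion row)
    have h2 : (S ∩ Finset.univ.biUnion row).card ≤ b :=
      (Finset.card_le_card Finset.inter_subset_left).trans hSb
    -- A move outside `Sp` and the rows does not raise Enforcer's allowance in the rows, so the
    -- reply should not enter them. It may do so only when it exhausts the outside part, which
    -- happens once and explains the surplus `+ 1`.
    by_cases heJ : e ∈ board \ (Sp ∪ Finset.univ.biUnion row)
    · have h3 := hI.enforcer_rows.resolve_right fun h => by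
        rcases Finset.mem_union.1 (h.1 heJ) with h | h
        · exact heA h
        · exact heE h
      have h4 := (Finset.mem_sdiff.1 heJ).2
      rw [Finset.mem_union, not_or] at h4
      simp only [h4, if_false, add_zero]
      rcases hSrest heJ with h | h
      · left
        have : (S ∩ Finset.univ.biUnion row).card = 0 := by
          rw [Finset.card_eq_zero, ← Finset.disjoint_iff_inter_eq_empty]
          refine Finset.disjoint_left.2 fun f hf hf' => ?_
          exact (Finset.mem_sdiff.1 (Finset.mem_inter.1 (h hf)).2).2
            (Finset.mem_union_right _ hf')
        omega
      · right
        refine ⟨hcl Finset.sdiff_subset h, ?_⟩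
        nlinarith
    · have h5 : 1 ≤ (if e ∈ Finset.univ.biUnion row then 1 else 0) + if e ∈ Sp then 1 else 0 := by
        by_contra h6
        refine heJ (Finset.mem_sdiff.2 ⟨heb, fun h7 => ?_⟩)
        rcases Finset.mem_union.1 h7 with h7 | h7 <;> simp [h7] at h6
      set u := if e ∈ Finset.univ.biUnion row then 1 else 0
      set v := if e ∈ Sp then 1 else 0
      rcases hI.enforcer_rows with h | ⟨h, h'⟩
      · left
        nlinarith
      · right
        exact ⟨h.trans hmono, by nlinarith⟩

/-- Enforcer can protect `Sp` until everything else has been claimed, with an almost even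
distribution of Avoider's elements over the rows. -/
theorem EnforcerWins.of_rows (hrow : ∀ i, row i ⊆ board)
    (hdisj : ∀ i j, i ≠ j → Disjoint (row i) (row j)) (hsp : ∀ i, Disjoint (row i) Sp)
    (hcard : ∀ i, (row i).card = D * (b + 1)) (s : ℕ)
    (H1 : ∀ p : Position α, p.avoider ⊆ board → Disjoint p.enforcer Sp →
      s ≤ (p.avoider ∩ Sp).card → EnforcerWins board b losing p)
    (H2 : ∀ p : Position α, p.avoider ⊆ board → (p.enforcer ∩ Sp).card ≤ b →
      (p.avoider ∩ Sp).card ≤ s → (∀ i, (p.avoider ∩ row i).card ≤ D) →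
      D * Fintype.card ι ≤ ∑ i, (p.avoider ∩ row i).card + s + 1 →
      EnforcerWins board b losing p) :
    EnforcerWins board b losing ⟨∅, ∅⟩ := by
  classical
  refine of_invariant (fun p => RowInvariant board b D row Sp p ∧ Disjoint p.enforcer Sp) ?_ ?_ _
    ⟨⟨by simp, by simp, by simp, by simp, by simp⟩, by simp⟩
  · rintro p ⟨hI, hE⟩ h0
    have hw : EnforcerWins board b losing p := by
      rcases le_total s (p.avoider ∩ Sp).card with h | h
      · exact H1 p hI.avoider_subset hE h
      · refine H2 p hI.avoider_subset ?_ h hI.avoider_row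
          (hI.card_le hrow hdisj hsp hcard h (by simp [h0]))
        rw [Finset.disjoint_iff_inter_eq_empty.1 hE]
        simp
    obtain ⟨_, _, h, _, _⟩ := hw
    exact h h0
  · rintro p ⟨hI, hE⟩ e he
    rcases le_or_gt s (p.avoider ∩ Sp).card with h | h
    · obtain ⟨_, S, _, hm, hw⟩ := H1 p hI.avoider_subset hE h
      have := hm e he
      rw [IsEnforcerMove, p.free_avoiderClaims] at this
      exact ⟨S e, this.1, this.2, Or.inr (hw e he)⟩
    set F := (p.free board).erase e with hF
    set J := board \ (Sp ∪ Finset.univ.biUnion row) with hJ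
    obtain ⟨T, hTS, hTrow, hTJ⟩ : ∃ T : Finset α, Disjoint T Sp ∧
        (∀ i, e ∈ row i → T = row i) ∧ (e ∈ J → T = J) := by
      by_cases h1 : ∃ i, e ∈ row i
      · obtain ⟨i, hi⟩ := h1
        refine ⟨row i, hsp i, fun j hj => ?_, fun h => ?_⟩
        · by_contra hne
          exact Finset.disjoint_left.1 (hdisj i j fun h => hne (h ▸ rfl)) hi hj
        · exact absurd (Finset.mem_union_right _ (Finset.mem_biUnion.2 ⟨i, Finset.mem_univ _, hi⟩))
            (Finset.mem_sdiff.1 h).2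
      · refine ⟨J, ?_, fun i hi => absurd ⟨i, hi⟩ h1, fun _ => rfl⟩
        exact Finset.disjoint_left.2 fun f hf hf' =>
          (Finset.mem_sdiff.1 hf).2 (Finset.mem_union_left _ hf')
    -- Order of preference: the part `T` that answers Avoider's move, then anything else outside
    -- `Sp`, and `Sp` last.
    obtain ⟨S, hS, hSc, hST, hSS⟩ := exists_greedy b
      (F := F ∩ T) (G := F \ Sp) (K := F)
      (fun f hf => Finset.mem_sdiff.2 ⟨(Finset.mem_inter.1 hf).1,
        Finset.disjoint_left.1 hTS (Finset.mem_inter.1 hf).2⟩) Finset.sdiff_subset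
    have hI' := hI.next hrow hcard he hS hSc (fun i hi => hTrow i hi ▸ hST)
      (fun h => by
        rw [hTJ h] at hST
        exact hST)
    refine ⟨S, hS, hSc, ?_⟩
    rcases hSS with hSS | hSS
    · refine Or.inl ⟨hI', ?_⟩
      exact Finset.disjoint_union_left.2 ⟨hE, Finset.disjoint_left.2 fun f hf =>
        (Finset.mem_sdiff.1 (hSS hf)).2⟩
    -- The reply exhausts everything outside `Sp` and can take at most `b` elements of `Sp`.
    · have heA : e ∉ p.avoider := fun h =>
        (Finset.mem_sdiff.1 he).2 (Finset.mem_union_left _ h)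
      have hAs : (((p.avoiderClaims e).enforcerClaims S).avoider ∩ Sp).card ≤ s := by
        change (insert e p.avoider ∩ Sp).card ≤ s
        rw [card_insert_inter heA]
        split_ifs <;> omega
      refine Or.inr (H2 _ hI'.avoider_subset ?_ hAs hI'.avoider_row
        (hI'.card_le hrow hdisj hsp hcard hAs ?_))
      · change ((p.enforcer ∪ S) ∩ Sp).card ≤ b
        rw [Finset.union_inter_distrib_right, Finset.disjoint_iff_inter_eq_empty.1 hE,
          Finset.empty_union]
        exact (Finset.card_le_card Finset.inter_subset_left).trans (by omega)
      · rw [p.free_next]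
        intro f hf
        obtain ⟨h1, h2⟩ := Finset.mem_sdiff.1 hf
        by_contra h3
        exact h2 (hSS (Finset.mem_sdiff.2 ⟨h1, h3⟩))

end Rows

end AvoiderEnforcer

/-! ### Embedding trees and unicyclic graphs greedily -/

section Embedding

open SimpleGraph

variable {W V : Type*}

/-- `f` embeds the part of `T` on the connected vertex set `D` into the part of `G` on `S`. -/
structure IsPartialCopy [DecidableEq W] (T : SimpleGraph W) (G : SimpleGraph V) (S : Finset V)
    (D : Finset W) (f : W → V) : Prop where
  mem : ∀ v ∈ D, f v ∈ S
  injOn : Set.InjOn f D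
  adj : ∀ u ∈ D, ∀ v ∈ D, T.Adj u v → G.Adj (f u) (f v)
  conn : ∀ u ∈ D, ∀ v ∈ D, ∃ q : T.Walk u v, ∀ x ∈ q.support, x ∈ D

/-- Two edges from `v` into the connected set `D` would give two different paths between their ends
in `D`, one through `v` and one inside `D`. -/
theorem IsPartialCopy.eq_of_adj [DecidableEq W] {T : SimpleGraph W} (hT : T.IsAcyclic)
    {G : SimpleGraph V} {S : Finset V} {D : Finset W} {f : W → V} (hf : IsPartialCopy T G S D f)
    {v u u' : W} (hv : v ∉ D) (hu : u ∈ D) (hu' : u' ∈ D) (h : T.Adj u v) (h' : T.Adj u' v) :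
    u = u' := by
  by_contra hne
  obtain ⟨q, hq⟩ := hf.conn u hu u' hu'
  have h2 : (Walk.cons h (Walk.cons h'.symm Walk.nil)).IsPath := by
    simp [Walk.cons_isPath_iff, h.ne, hne, h'.ne.symm]
  have h3 := (hT.subsingleton_path u u').elim ⟨_, h2⟩ ⟨_, q.bypass_isPath⟩
  have h4 : v ∈ q.bypass.support := by
    rw [← Subtype.mk.inj h3]
    simp
  exact hv (hq v (q.support_bypass_subset_support h4))

/-- The new vertex has only one neighbour in `D` by `IsPartialCopy.eq_of_adj`, so a single adjacency
in `G` suffices. -/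
theorem IsPartialCopy.extend [DecidableEq W] {T : SimpleGraph W} (hT : T.IsAcyclic)
    {G : SimpleGraph V} {S : Finset V} {D : Finset W} {f : W → V} (hf : IsPartialCopy T G S D f)
    {v u : W} (hv : v ∉ D) (hu : u ∈ D) (h : T.Adj u v) {g : V} (hg : g ∈ S)
    (hgf : ∀ w ∈ D, f w ≠ g) (hadj : G.Adj (f u) g) :
    IsPartialCopy T G S (insert v D) (Function.update f v g) := by
  have hup : ∀ w ∈ D, Function.update f v g w = f w := fun w hw =>
    Function.update_of_ne (ne_of_mem_of_not_mem hw hv) _ _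
  refine ⟨?_, ?_, ?_, ?_⟩
  · intro w hw
    rcases Finset.mem_insert.1 hw with rfl | hw
    · simpa using hg
    · rw [hup w hw]
      exact hf.mem w hw
  · intro w hw w' hw' he
    rcases Finset.mem_insert.1 hw with rfl | h1 <;> rcases Finset.mem_insert.1 hw' with rfl | h2
    · rfl
    · rw [hup _ h2, Function.update_self] at he
      exact absurd he.symm (hgf _ h2)
    · rw [hup _ h1, Function.update_self] at he
      exact absurd he (hgf _ h1)
    · rw [hup _ h1, hup _ h2] at he
      exact hf.injOn h1 h2 he
  · intro w hw w' hw' he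
    rcases Finset.mem_insert.1 hw with rfl | h1 <;> rcases Finset.mem_insert.1 hw' with rfl | h2
    · exact absurd he (T.loopless.irrefl _)
    · rw [hup _ h2, Function.update_self, ← hf.eq_of_adj hT hv hu h2 h he.symm]
      exact hadj.symm
    · rw [hup _ h1, Function.update_self, ← hf.eq_of_adj hT hv hu h1 h he]
      exact hadj
    · rw [hup _ h1, hup _ h2]
      exact hf.adj w h1 w' h2 he
  · have key : ∀ w ∈ D, ∃ q : T.Walk w v, ∀ x ∈ q.support, x ∈ insert v D := by
      intro w hw
      obtain ⟨q, hq⟩ := hf.conn w hw u hu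
      refine ⟨q.concat h, fun x hx => ?_⟩
      rw [Walk.support_concat, List.mem_append, List.mem_singleton] at hx
      exact Finset.mem_insert.2 (hx.symm.imp_right (hq x))
    intro w hw w' hw'
    rcases Finset.mem_insert.1 hw with rfl | h1 <;> rcases Finset.mem_insert.1 hw' with rfl | h2
    · exact ⟨Walk.nil, by simp⟩
    · obtain ⟨q, hq⟩ := key w' h2
      exact ⟨q.reverse, by simpa using hq⟩
    · exact key w h1
    · obtain ⟨q, hq⟩ := hf.conn w h1 w' h2
      exact ⟨q, fun x hx => Finset.mem_insert_of_mem (hq x hx)⟩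

/-- A partial copy of a tree can be completed in a graph of large minimum degree. -/
theorem IsPartialCopy.exists_extension [DecidableEq W] [Fintype W] [DecidableEq V]
    {T : SimpleGraph W} (hT : T.IsTree)
    {G : SimpleGraph V} [DecidableRel G.Adj] {S : Finset V}
    (hS : ∀ x ∈ S, Fintype.card W ≤ (S.filter (G.Adj x)).card) (m : ℕ) (D : Finset W) (f : W → V)
    (hm : Dᶜ.card = m) (hne : D.Nonempty) (hf : IsPartialCopy T G S D f) :
    ∃ f', IsPartialCopy T G S Finset.univ f' ∧ ∀ w ∈ D, f' w = f w := by
  induction m generalizing D f with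
  | zero =>
    rw [Finset.card_eq_zero, Finset.compl_eq_empty_iff] at hm
    subst hm
    exact ⟨f, hf, fun _ _ => rfl⟩
  | succ m ih =>
    obtain ⟨a, ha⟩ := hne
    obtain ⟨z, hz⟩ := Finset.card_pos.1 (show 0 < Dᶜ.card by omega)
    obtain ⟨q⟩ := hT.connected.preconnected a z
    obtain ⟨d, -, hd1, hd2⟩ := q.exists_boundary_dart (D : Set W) ha
      (by simpa using hz)
    have hv : d.snd ∉ D := hd2
    have hu : d.fst ∈ D := hd1
    have hlt : (D.image f).card < (insert (f d.fst) (S.filter (G.Adj (f d.fst)))).card := by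
      rw [Finset.card_insert_of_notMem (by simp)]
      have h1 := hS _ (hf.mem _ hu)
      have h2 := Finset.card_image_le (s := D) (f := f)
      have h3 := Finset.card_le_univ D
      omega
    obtain ⟨g, hg, hgD⟩ := Finset.exists_mem_notMem_of_card_lt_card hlt
    have hgf : ∀ w ∈ D, f w ≠ g := fun w hw h =>
      hgD (Finset.mem_image.2 ⟨w, hw, h⟩)
    have hg' := (Finset.mem_insert.1 hg).resolve_left (hgf _ hu).symm
    rw [Finset.mem_filter] at hg'
    have hext := hf.extend hT.isAcyclic hv hu d.adj hg'.1 hgf hg'.2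
    have hc : (insert d.snd D)ᶜ.card = m := by
      rw [Finset.card_compl, Finset.card_insert_of_notMem hv]
      rw [Finset.card_compl] at hm
      omega
    obtain ⟨f', hf', hag⟩ := ih _ _ hc (Finset.insert_nonempty _ _) hext
    refine ⟨f', hf', fun w hw => ?_⟩
    rw [hag w (Finset.mem_insert_of_mem hw), Function.update_of_ne (ne_of_mem_of_not_mem hw hv)]

theorem IsUnicyclic.toSubgraph_eq {H : SimpleGraph W} (hH : IsUnicyclic H) {v : W}
    {c : H.Walk v v} (hc : c.IsCycle) {u : W} {d : H.Walk u u} (hd : d.IsCycle) :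
    c.toSubgraph = d.toSubgraph :=
  hH.2.unique ⟨v, c, hc, rfl⟩ ⟨u, d, hd, rfl⟩

/-- A unicyclic graph becomes a tree when an edge of its cycle is deleted. -/
theorem IsUnicyclic.isTree {H : SimpleGraph W} (hH : IsUnicyclic H) {v : W}
    {c : H.Walk v v} (hc : c.IsCycle) {x y : W} (hxy : c.toSubgraph.Adj x y) :
    (H.deleteEdges {s(x, y)}).IsTree := by
  have hmem : s(x, y) ∈ c.edges := c.adj_toSubgraph_iff_mem_edges.1 hxy
  refine ⟨?_, ?_⟩
  · refine hH.1.connected_delete_edge_of_not_isBridge fun hb => ?_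
    exact (isBridge_iff_forall_cycle_notMem (H.mem_edgeSet.2 hxy.adj_sub)).1 hb c hc hmem
  -- A cycle avoiding the deleted edge is a cycle of `H`, hence the same subgraph as `c`, which
  -- contains that edge.
  · intro a d hd
    have hle : H.deleteEdges {s(x, y)} ≤ H := H.deleteEdges_le _
    have h1 := hH.toSubgraph_eq hc (hd.mapLe hle)
    rw [h1, Walk.adj_toSubgraph_iff_mem_edges, Walk.edges_mapLe_eq_edges] at hxy
    simpa using d.edges_subset_edgeSet hxy

/-- A graph of large minimum degree on `S` in which there is a cycle of the right length contains
the unicyclic graph `H`. -/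
theorem IsUnicyclic.isContained [Fintype W] [DecidableEq V] {H : SimpleGraph W}
    (hH : IsUnicyclic H) {v : W} {c : H.Walk v v} (hc : c.IsCycle) {G : SimpleGraph V}
    [DecidableRel G.Adj] {S : Finset V}
    (hS : ∀ x ∈ S, Fintype.card W ≤ (S.filter (G.Adj x)).card) {p : ℕ → V}
    (hpS : ∀ i < c.length, p i ∈ S) (hinj : ∀ i < c.length, ∀ j < c.length, p i = p j → i = j)
    (hadj : ∀ i, i + 1 < c.length → G.Adj (p i) (p (i + 1)))
    (hclose : G.Adj (p (c.length - 1)) (p 0)) : H ⊑ G := by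
  classical
  have h3 := hc.three_le_length
  have hci : ∀ i < c.length, ∀ j < c.length, c.getVert i = c.getVert j → i = j :=
    fun i hi j hj h => hc.getVert_injOn' (by simp; omega) (by simp; omega) h
  have hlast : c.toSubgraph.Adj (c.getVert (c.length - 1)) (c.getVert 0) := by
    have := c.toSubgraph_adj_getVert (i := c.length - 1) (by omega)
    have h0 : c.getVert (c.length - 1 + 1) = c.getVert 0 := by
      rw [show c.length - 1 + 1 = c.length by omega, c.getVert_length, c.getVert_zero]
    rwa [h0] at this
  -- Without its closing edge the cycle is a path in the tree `T`. This path is sent to `p`, the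
  -- rest of `T` is placed greedily, and `hclose` restores the deleted edge.
  set T := H.deleteEdges {s(c.getVert (c.length - 1), c.getVert 0)} with hTdef
  have hT : T.IsTree := hH.isTree hc hlast
  have hTadj : ∀ i, i + 1 < c.length → T.Adj (c.getVert i) (c.getVert (i + 1)) := by
    intro i hi
    rw [hTdef, deleteEdges_adj]
    refine ⟨c.adj_getVert_succ (by omega), fun h => ?_⟩
    rw [Set.mem_singleton_iff, Sym2.eq_iff] at h
    rcases h with ⟨-, h⟩ | ⟨h1, h2⟩
    · have := hci _ hi _ (by omega) h
      omega
    · have := hci _ (by omega) _ (by omega) h1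
      have := hci _ hi _ (by omega) h2
      omega
  have hpath : ∀ m < c.length, ∃ f, IsPartialCopy T G S
      ((Finset.range (m + 1)).image c.getVert) f ∧ ∀ i ≤ m, f (c.getVert i) = p i := by
    intro m
    induction m with
    | zero =>
      intro hm
      refine ⟨fun _ => p 0, ⟨?_, ?_, ?_, ?_⟩, ?_⟩
      · exact fun _ _ => hpS 0 hm
      · simp
      · simp
      · simp only [zero_add, Finset.range_one, Finset.image_singleton, Finset.mem_singleton]
        rintro u rfl v rfl
        exact ⟨Walk.nil, by simp⟩
      · intro i hi
        simp [Nat.le_zero.1 hi]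
    | succ m ih =>
      intro hm
      obtain ⟨f, hf, hfp⟩ := ih (by omega)
      have hv : c.getVert (m + 1) ∉ (Finset.range (m + 1)).image c.getVert := by
        intro h
        obtain ⟨i, hi, h⟩ := Finset.mem_image.1 h
        rw [Finset.mem_range] at hi
        have := hci _ (by omega) _ hm h
        omega
      have hu : c.getVert m ∈ (Finset.range (m + 1)).image c.getVert :=
        Finset.mem_image_of_mem _ (by simp)
      have hext := hf.extend hT.isAcyclic hv hu (hTadj m hm) (hpS _ hm) (g := p (m + 1)) ?_ ?_
      · rw [← Finset.image_insert, ← Finset.range_add_one] at hext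
        refine ⟨_, hext, fun i hi => ?_⟩
        rcases Nat.le_succ_iff.1 hi with h | h
        · rw [Function.update_of_ne, hfp i h]
          intro h'
          have := hci _ (by omega) _ hm h'
          omega
        · subst h
          simp
      · intro w hw h
        obtain ⟨i, hi, rfl⟩ := Finset.mem_image.1 hw
        rw [Finset.mem_range] at hi
        rw [hfp i (by omega)] at h
        have := hinj _ (by omega) _ hm h
        omega
      · rw [hfp m le_rfl]
        exact hadj m hm
  obtain ⟨f, hf, hfp⟩ := hpath (c.length - 1) (by omega)
  obtain ⟨f', hf', hag⟩ := hf.exists_extension hT hS _ _ _ rfl (by simp)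
  have hcyc : ∀ i < c.length, f' (c.getVert i) = p i := fun i hi => by
    rw [hag _ (Finset.mem_image_of_mem _ (Finset.mem_range.2 (by omega))), hfp i (by omega)]
  refine ⟨⟨⟨f', fun {a b} hab => ?_⟩, fun a b hab =>
    hf'.injOn (Finset.mem_coe.2 (Finset.mem_univ a)) (Finset.mem_coe.2 (Finset.mem_univ b)) hab⟩⟩
  by_cases he : s(a, b) = s(c.getVert (c.length - 1), c.getVert 0)
  · rw [Sym2.eq_iff] at he
    rcases he with ⟨rfl, rfl⟩ | ⟨rfl, rfl⟩
    · rw [hcyc _ (by omega), hcyc _ (by omega)]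
      exact hclose
    · rw [hcyc _ (by omega), hcyc _ (by omega)]
      exact hclose.symm
  · refine hf'.adj a (Finset.mem_univ a) b (Finset.mem_univ b) ?_
    rw [hTdef, deleteEdges_adj]
    exact ⟨hab, by simpa using he⟩

end Embedding

/-! ### Degrees, cores and paths in edge sets -/

section EdgeSets

open SimpleGraph

variable {V : Type*} [DecidableEq V]

/-- The neighbours of `v` in `S` with respect to the edge set `B`. -/
def edgeNeighbors (B : Finset (Sym2 V)) (S : Finset V) (v : V) : Finset V :=
  S.filter fun w => s(v, w) ∈ B

/-- The edges of `B` inside the vertex set `S`. -/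
def edgesWithin (B : Finset (Sym2 V)) (S : Finset V) : Finset (Sym2 V) :=
  B.filter fun e => e ∈ S.sym2

theorem mem_edgeNeighbors {B : Finset (Sym2 V)} {S : Finset V} {v w : V} :
    w ∈ edgeNeighbors B S v ↔ w ∈ S ∧ s(v, w) ∈ B := Finset.mem_filter

theorem card_edgesWithin_erase_le (B : Finset (Sym2 V)) (S : Finset V) (v : V) :
    (edgesWithin B S).card ≤ (edgesWithin B (S.erase v)).card + (edgeNeighbors B S v).card := by
  have hsub : edgesWithin B S ⊆
      edgesWithin B (S.erase v) ∪ (edgeNeighbors B S v).image fun w => s(v, w) := by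
    intro e he
    obtain ⟨heB, heS⟩ := Finset.mem_filter.1 he
    rw [Finset.mem_sym2_iff] at heS
    by_cases hv : v ∈ e
    · obtain ⟨w, rfl⟩ := hv
      exact Finset.mem_union_right _ (Finset.mem_image_of_mem _
        (mem_edgeNeighbors.2 ⟨heS w (Sym2.mem_mk_right v w), heB⟩))
    · refine Finset.mem_union_left _ (Finset.mem_filter.2 ⟨heB, Finset.mem_sym2_iff.2 fun a ha => ?_⟩)
      exact Finset.mem_erase.2 ⟨fun h => hv (h ▸ ha), heS a ha⟩
  exact (Finset.card_le_card hsub).trans ((Finset.card_union_le _ _).trans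
    (Nat.add_le_add_left Finset.card_image_le _))

theorem card_edgesWithin_sdiff_le (B : Finset (Sym2 V)) (S X : Finset V) :
    (edgesWithin B S).card ≤
      (edgesWithin B (S \ X)).card + ∑ v ∈ X, (edgeNeighbors B S v).card := by
  induction X using Finset.induction_on with
  | empty => simp
  | insert v X hv ih =>
    rw [Finset.sum_insert hv, Finset.sdiff_insert]
    have h1 := card_edgesWithin_erase_le B (S \ X) v
    have h2 : (edgeNeighbors B (S \ X) v).card ≤ (edgeNeighbors B S v).card :=
      Finset.card_le_card (Finset.filter_subset_filter _ Finset.sdiff_subset)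
    omega

/-- Many edges in `S` give a large part of `S` of large minimum degree. -/
theorem exists_core (B : Finset (Sym2 V)) (h : ℕ) (S : Finset V) :
    ∃ S' ⊆ S, (∀ v ∈ S', h ≤ (edgeNeighbors B S' v).card) ∧
      (edgesWithin B S).card + h * S'.card ≤ (edgesWithin B S').card + h * S.card := by
  induction hn : S.card generalizing S with
  | zero => exact ⟨S, Finset.Subset.refl _, by simp [Finset.card_eq_zero.1 hn], by rw [hn]⟩
  | succ n ih =>
    by_cases hS : ∀ v ∈ S, h ≤ (edgeNeighbors B S v).card
    · exact ⟨S, Finset.Subset.refl _, hS, by rw [hn]⟩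
    · push Not at hS
      obtain ⟨v, hv, hlt⟩ := hS
      obtain ⟨S', hS', hdeg, hc⟩ := ih (S.erase v) (by rw [Finset.card_erase_of_mem hv]; omega)
      refine ⟨S', hS'.trans (Finset.erase_subset _ _), hdeg, ?_⟩
      have := card_edgesWithin_erase_le B S v
      rw [mul_add, mul_one]
      omega

theorem nonempty_of_edgesWithin {B : Finset (Sym2 V)} {S : Finset V}
    (h : 0 < (edgesWithin B S).card) : S.Nonempty := by
  obtain ⟨e, he⟩ := Finset.card_pos.1 h
  induction e with
  | _ a b => exact ⟨a, Finset.mem_sym2_iff.1 (Finset.mem_filter.1 he).2 a (Sym2.mem_mk_left a b)⟩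

/-- Paths of a given length exist in parts of large minimum degree. -/
theorem exists_path {B : Finset (Sym2 V)} (hB : ∀ e ∈ B, ¬ e.IsDiag) {S : Finset V} {d : ℕ}
    (hS : ∀ v ∈ S, d ≤ (edgeNeighbors B S v).card) {v : V} (hv : v ∈ S) (m : ℕ) (hm : m ≤ d) :
    ∃ p : ℕ → V, p 0 = v ∧ (∀ i ≤ m, p i ∈ S) ∧ (∀ i ≤ m, ∀ j ≤ m, p i = p j → i = j) ∧
      ∀ i < m, s(p i, p (i + 1)) ∈ B := by
  induction m with
  | zero =>
    exact ⟨fun _ => v, rfl, fun _ _ => hv, fun i hi j hj _ => by omega, fun i hi => by omega⟩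
  | succ m ih =>
    obtain ⟨p, h0, hpS, hinj, hadj⟩ := ih (by omega)
    have hlt : ((Finset.range m).image p).card < (edgeNeighbors B S (p m)).card := by
      have h1 := hS _ (hpS m le_rfl)
      have h2 := Finset.card_image_le (s := Finset.range m) (f := p)
      rw [Finset.card_range] at h2
      omega
    obtain ⟨w, hw, hwp⟩ := Finset.exists_mem_notMem_of_card_lt_card hlt
    obtain ⟨hwS, hwB⟩ := mem_edgeNeighbors.1 hw
    have hne : ∀ i ≤ m, p i ≠ w := by
      intro i hi h
      rcases hi.lt_or_eq with hi | rfl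
      · exact hwp (Finset.mem_image.2 ⟨i, Finset.mem_range.2 hi, h⟩)
      · exact hB _ hwB (by simpa using h)
    have hup : ∀ i ≤ m, Function.update p (m + 1) w i = p i := fun i hi =>
      Function.update_of_ne (by omega) _ _
    refine ⟨Function.update p (m + 1) w, by rw [hup 0 (by omega), h0], ?_, ?_, ?_⟩
    · intro i hi
      rcases Nat.le_succ_iff.1 hi with hi | rfl
      · rw [hup i hi]
        exact hpS i hi
      · simpa using hwS
    · intro i hi j hj he
      rcases Nat.le_succ_iff.1 hi with hi | rfl <;> rcases Nat.le_succ_iff.1 hj with hj | rfl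
      · rw [hup i hi, hup j hj] at he
        exact hinj i hi j hj he
      · rw [hup i hi, Function.update_self] at he
        exact absurd he (hne i hi)
      · rw [hup j hj, Function.update_self] at he
        exact absurd he.symm (hne j hj)
      · rfl
    · intro i hi
      rcases (Nat.lt_succ_iff.1 hi).lt_or_eq with hi | rfl
      · rw [hup i (by omega), hup (i + 1) (by omega)]
        exact hadj i hi
      · rw [hup i le_rfl, Function.update_self]
        exact hwB

/-! ### Edges whose addition completes a copy of `H` -/

variable {W : Type*} [Fintype W] {H : SimpleGraph W} {v₀ : W} {c : H.Walk v₀ v₀}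

theorem IsCycle.length_le_card (hc : c.IsCycle) : c.length ≤ Fintype.card W := by
  have := hc.support_nodup.length_le_card
  simpa using this

/-- The degrees are measured in `B` alone, while the cycle may also use further edges of `B'`: in
the applications, the pairs that Avoider has yet to claim. -/
theorem IsUnicyclic.isContained_fromEdgeSet (hH : IsUnicyclic H) (hc : c.IsCycle)
    {B B' : Finset (Sym2 V)} (hB : ∀ e ∈ B, ¬ e.IsDiag) (hBB : B ⊆ B') {S : Finset V}
    (hS : ∀ x ∈ S, Fintype.card W ≤ (edgeNeighbors B S x).card) {p : ℕ → V}
    (hpS : ∀ i < c.length, p i ∈ S) (hinj : ∀ i < c.length, ∀ j < c.length, p i = p j → i = j)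
    (hadj : ∀ i, i + 1 < c.length → s(p i, p (i + 1)) ∈ B')
    (hclose : s(p (c.length - 1), p 0) ∈ B') : H ⊑ fromEdgeSet (B' : Set (Sym2 V)) := by
  classical
  have h3 := hc.three_le_length
  refine hH.isContained hc (S := S) (p := p) ?_ hpS hinj ?_ ?_
  · intro x hx
    refine (hS x hx).trans (Finset.card_le_card fun w hw => ?_)
    obtain ⟨hwS, hwB⟩ := mem_edgeNeighbors.1 hw
    refine Finset.mem_filter.2 ⟨hwS, (fromEdgeSet_adj _).2 ⟨hBB hwB, fun h => ?_⟩⟩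
    exact hB _ hwB (by simpa using h)
  · refine fun i hi => (fromEdgeSet_adj _).2 ⟨hadj i hi, fun h => ?_⟩
    have := hinj _ (by omega) _ hi h
    omega
  · refine (fromEdgeSet_adj _).2 ⟨hclose, fun h => ?_⟩
    have := hinj _ (by omega) _ (by omega) h
    omega

/-- A graph with many edges inside `S` contains `H`, or there are many pairs in `S` the addition of
which creates a copy of `H`. -/
theorem IsUnicyclic.exists_threats (hH : IsUnicyclic H) (hc : c.IsCycle)
    {B : Finset (Sym2 V)} (hB : ∀ e ∈ B, ¬ e.IsDiag) (S : Finset V) :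
    H ⊑ fromEdgeSet (B : Set (Sym2 V)) ∨ ∃ Θ : Finset (Sym2 V), Θ ⊆ S.sym2 ∧
      (∀ f ∈ Θ, ¬ f.IsDiag ∧ f ∉ B ∧
        H ⊑ fromEdgeSet ((insert f B : Finset (Sym2 V)) : Set (Sym2 V))) ∧
      (edgesWithin B S).card ≤ Θ.card + Fintype.card W * S.card := by
  by_cases hcont : H ⊑ fromEdgeSet (B : Set (Sym2 V))
  · exact Or.inl hcont
  right
  have h3 := hc.three_le_length
  have hk := IsCycle.length_le_card hc
  induction hn : S.card generalizing S with
  | zero =>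
    refine ⟨∅, by simp, by simp, ?_⟩
    rw [Finset.card_eq_zero] at hn
    subst hn
    by_contra h
    simpa using nonempty_of_edgesWithin (B := B) (S := ∅) (by omega)
  | succ n ih =>
    -- Delete vertices of minimum degree one by one. A degree `d` below `|W|` is absorbed by the
    -- error term. Otherwise a path of length `k - 2` from `v` extends to at least `d - (k - 2)` new
    -- vertices `w`, and each pair `vw` closes a `k`-cycle; these threats contain `v`, so they are
    -- new.
    obtain ⟨v, hv, hmin⟩ := S.exists_min_image (fun v => (edgeNeighbors B S v).card)
      (Finset.card_pos.1 (by omega))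
    obtain ⟨Θ, hΘS, hΘ, hΘc⟩ := ih (S.erase v) (by rw [Finset.card_erase_of_mem hv]; omega)
    have herase := card_edgesWithin_erase_le B S v
    have hsub : (S.erase v).sym2 ⊆ S.sym2 := Finset.sym2_mono (Finset.erase_subset _ _)
    rcases lt_or_ge (edgeNeighbors B S v).card (Fintype.card W) with hd | hd
    · exact ⟨Θ, hΘS.trans hsub, hΘ, by rw [mul_add, mul_one]; omega⟩
    obtain ⟨p, hp0, hpS, hinj, hadj⟩ := exists_path hB hmin hv (c.length - 2) (by omega)
    set N := edgeNeighbors B S (p (c.length - 2)) \ (Finset.range (c.length - 2)).image p with hN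
    have hNc : (edgeNeighbors B S v).card ≤ N.card + (c.length - 2) := by
      have h1 := hmin _ (hpS _ le_rfl)
      have h2 := Finset.card_image_le (s := Finset.range (c.length - 2)) (f := p)
      have h4 := Finset.le_card_sdiff ((Finset.range (c.length - 2)).image p)
        (edgeNeighbors B S (p (c.length - 2)))
      rw [Finset.card_range] at h2
      rw [← hN] at h4
      omega
    have hNw : ∀ w ∈ N, w ∈ S ∧ s(p (c.length - 2), w) ∈ B ∧ ∀ i ≤ c.length - 2, p i ≠ w := by
      intro w hw
      obtain ⟨h1, h2⟩ := Finset.mem_sdiff.1 hw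
      obtain ⟨hwS, hwB⟩ := mem_edgeNeighbors.1 h1
      refine ⟨hwS, hwB, fun i hi h => ?_⟩
      rcases hi.lt_or_eq with hi | rfl
      · exact h2 (Finset.mem_image.2 ⟨i, Finset.mem_range.2 hi, h⟩)
      · exact hB _ hwB (by simpa using h)
    have hcopy : ∀ w ∈ N, H ⊑ fromEdgeSet ((insert s(v, w) B : Finset (Sym2 V)) : Set (Sym2 V)) := by
      intro w hw
      obtain ⟨hwS, hwB, hwp⟩ := hNw w hw
      have hup : ∀ i ≤ c.length - 2, Function.update p (c.length - 1) w i = p i := fun i hi =>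
        Function.update_of_ne (by omega) _ _
      have hcase : ∀ i < c.length, i ≤ c.length - 2 ∨ i = c.length - 1 := by omega
      refine hH.isContained_fromEdgeSet hc hB (Finset.subset_insert _ _) (S := S)
        (p := Function.update p (c.length - 1) w) (fun x hx => hd.trans (hmin x hx)) ?_ ?_ ?_ ?_
      · intro i hi
        rcases hcase i hi with hi | rfl
        · rw [hup i hi]
          exact hpS i hi
        · simpa using hwS
      · intro i hi j hj he
        rcases hcase i hi with hi | rfl <;> rcases hcase j hj with hj | rfl
        · rw [hup i hi, hup j hj] at he
          exact hinj i hi j hj he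
        · rw [hup i hi, Function.update_self] at he
          exact absurd he (hwp i hi)
        · rw [hup j hj, Function.update_self] at he
          exact absurd he.symm (hwp j hj)
        · rfl
      · intro i hi
        refine Finset.mem_insert_of_mem ?_
        rw [hup i (by omega)]
        rcases (show i + 1 ≤ c.length - 2 ∨ i = c.length - 2 by omega) with h | rfl
        · rw [hup _ h]
          exact hadj i (by omega)
        · rw [show c.length - 2 + 1 = c.length - 1 by omega, Function.update_self]
          exact hwB
      · rw [Function.update_self, hup 0 (by omega), hp0, Sym2.eq_swap]
        exact Finset.mem_insert_self _ _
    have hNB : ∀ w ∈ N, s(v, w) ∉ B := by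
      intro w hw h
      have := hcopy w hw
      rw [Finset.insert_eq_of_mem h] at this
      exact hcont this
    refine ⟨Θ ∪ N.image fun w => s(v, w), ?_, ?_, ?_⟩
    · refine Finset.union_subset (hΘS.trans hsub) fun f hf => ?_
      obtain ⟨w, hw, rfl⟩ := Finset.mem_image.1 hf
      exact Finset.mk_mem_sym2_iff.2 ⟨hv, (hNw w hw).1⟩
    · intro f hf
      rcases Finset.mem_union.1 hf with hf | hf
      · exact hΘ f hf
      · obtain ⟨w, hw, rfl⟩ := Finset.mem_image.1 hf
        refine ⟨fun h => (hNw w hw).2.2 0 (by omega) ?_, hNB w hw, hcopy w hw⟩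
        rw [hp0]
        simpa using h
    · have hdis : Disjoint Θ (N.image fun w => s(v, w)) := by
        refine Finset.disjoint_right.2 fun f hf hf' => ?_
        obtain ⟨w, hw, rfl⟩ := Finset.mem_image.1 hf
        have := (Finset.mk_mem_sym2_iff.1 (hΘS hf')).1
        simp at this
      rw [Finset.card_union_of_disjoint hdis, Finset.card_image_of_injective _
        (fun a b hab => Sym2.congr_right.1 hab), mul_add, mul_one]
      omega

/-- Each pair of `U` is counted at most once from either end. -/
theorem sum_card_edgeNeighbors_le (U : Finset (Sym2 V)) (S : Finset V) :
    ∑ z ∈ S, (edgeNeighbors U S z).card ≤ 2 * U.card := by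
  have h1 : ∑ z ∈ S, (edgeNeighbors U S z).card =
      ((S ×ˢ S).filter fun q => s(q.1, q.2) ∈ U).card := by
    rw [Finset.card_filter, Finset.sum_product]
    exact Finset.sum_congr rfl fun z _ => by rw [edgeNeighbors, Finset.card_filter]
  rw [h1]
  refine Finset.card_le_mul_card_image_of_maps_to (f := fun q : V × V => s(q.1, q.2))
    (fun q hq => (Finset.mem_filter.1 hq).2) 2 fun e he => ?_
  induction e with
  | _ a b =>
    refine (Finset.card_le_card (t := {(a, b), (b, a)}) fun q hq => ?_).trans Finset.card_le_two
    obtain ⟨x, y⟩ := q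
    have := (Finset.mem_filter.1 hq).2
    simpa [Sym2.eq_iff] using this

theorem injective_vec3 {V : Type*} {a b c : V} (hab : a ≠ b) (hac : a ≠ c) (hbc : b ≠ c) :
    Function.Injective ![a, b, c] := by
  intro i j hij
  fin_cases i <;> fin_cases j <;> simp_all

/-- In a dense bipartite graph without vertices of large degree on the side `X` there are three
pairs in `X` with a common element such that adding the first pair and one of the others creates
a copy of `H`. A given small set `U` of pairs can be avoided. -/
theorem IsUnicyclic.exists_triple (hH : IsUnicyclic H) (hc : c.IsCycle) (heven : Even c.length)
    {A B U : Finset (Sym2 V)} (hBA : B ⊆ A) {X S : Finset V}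
    (hbip : ∀ u v, s(u, v) ∈ B → (u ∈ X ↔ v ∉ X))
    (hS : ∀ v ∈ S, Fintype.card W ≤ (edgeNeighbors B S v).card) {D β : ℕ}
    (hD : ∀ v ∈ X, (edgeNeighbors B S v).card ≤ D)
    (hU : 2 * U.card < (β + 1) * (S ∩ X).card)
    (hcard : Fintype.card W * S.card + D * (β + 1) < (edgesWithin B S).card) :
    ∃ z ∈ X, ∃ x : Fin 3 → V, Function.Injective x ∧
      (∀ i, x i ∈ X ∧ x i ≠ z ∧ s(z, x i) ∉ U) ∧
      ∀ i, i ≠ 0 → H ⊑ fromEdgeSet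
        ((insert s(z, x 0) (insert s(z, x i) A) : Finset (Sym2 V)) : Set (Sym2 V)) := by
  have h3 := hc.three_le_length
  have hk := IsCycle.length_le_card hc
  have h4 : 4 ≤ c.length := by
    obtain ⟨r, hr⟩ := heven
    omega
  have hB : ∀ e ∈ B, ¬ e.IsDiag := by
    intro e he hdiag
    induction e with
    | _ a b =>
      rw [Sym2.mk_isDiag_iff] at hdiag
      subst hdiag
      have := hbip a a he
      tauto
  obtain ⟨z, hz, hzU⟩ : ∃ z ∈ S ∩ X, (edgeNeighbors U (S ∩ X) z).card ≤ β := by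
    by_contra! hcon
    have h1 := Finset.card_nsmul_le_sum _ _ (β + 1) hcon
    have h2 := sum_card_edgeNeighbors_le U (S ∩ X)
    rw [smul_eq_mul, mul_comm] at h1
    omega
  obtain ⟨hzS, hzX⟩ := Finset.mem_inter.1 hz
  -- Outside `R`, every vertex of `S ∩ X` forms with `z` a pair not in `U`. Since `R ⊆ X`, deleting
  -- it costs at most `D(β + 1)` edges.
  set R := insert z (edgeNeighbors U (S ∩ X) z) with hR
  have hRc : R.card ≤ β + 1 := (Finset.card_insert_le _ _).trans (by omega)
  have hRX : R ⊆ X := Finset.insert_subset hzX fun w hw =>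
    (Finset.mem_inter.1 (mem_edgeNeighbors.1 hw).1).2
  have h5 : Fintype.card W * S.card < (edgesWithin B (S \ R)).card := by
    have h6 := card_edgesWithin_sdiff_le B S R
    have h7 : ∑ v ∈ R, (edgeNeighbors B S v).card ≤ R.card * D :=
      Finset.sum_le_card_nsmul _ _ _ fun v hv => hD v (hRX hv)
    have h8 : R.card * D ≤ (β + 1) * D := Nat.mul_le_mul_right _ hRc
    rw [mul_comm D] at hcard
    omega
  obtain ⟨S₁, hS₁, hdeg, hc₁⟩ := exists_core B (Fintype.card W) (S \ R)
  have h6 : Fintype.card W * (S \ R).card ≤ Fintype.card W * S.card :=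
    Nat.mul_le_mul_left _ (Finset.card_le_card Finset.sdiff_subset)
  obtain ⟨x₀, hx₀, hx₀X⟩ : ∃ x₀ ∈ S₁, x₀ ∈ X := by
    obtain ⟨v, hv⟩ := nonempty_of_edgesWithin (B := B) (S := S₁) (by omega)
    by_cases hvX : v ∈ X
    · exact ⟨v, hv, hvX⟩
    · have := hdeg v hv
      obtain ⟨w, hw⟩ := Finset.card_pos.1 (show 0 < (edgeNeighbors B S₁ v).card by omega)
      obtain ⟨hwS, hwB⟩ := mem_edgeNeighbors.1 hw
      refine ⟨w, hwS, ?_⟩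
      have := hbip v w hwB
      tauto
  have hS₁S : ∀ v ∈ S₁, v ∈ S ∧ v ∉ R := fun v hv => Finset.mem_sdiff.1 (hS₁ hv)
  -- The length `k - 3` is odd, so the path ends outside `X` and the next vertex `w` lies in `X`.
  -- Evenness of the cycle is what places both pairs at `z` inside `X`.
  obtain ⟨p, hp0, hpS, hinj, hadj⟩ := exists_path hB hdeg hx₀ (c.length - 3) (by omega)
  have hpar : ∀ i ≤ c.length - 3, (p i ∈ X ↔ Even i) := by
    intro i
    induction i with
    | zero => simp [hp0, hx₀X]
    | succ i ih =>
      intro hi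
      have h1 := hbip _ _ (hadj i (by omega))
      have h2 := ih (by omega)
      rw [Nat.even_add_one]
      tauto
  have hlast : p (c.length - 3) ∉ X := by
    rw [hpar _ le_rfl, Nat.not_even_iff_odd]
    obtain ⟨r, hr⟩ := heven
    exact ⟨r - 2, by omega⟩
  set N := edgeNeighbors B S₁ (p (c.length - 3)) \ (Finset.range (c.length - 3)).image p with hN
  have hNc : 1 < N.card := by
    have h1 := hdeg _ (hpS _ le_rfl)
    have h2 := Finset.card_image_le (s := Finset.range (c.length - 3)) (f := p)
    have h4 := Finset.le_card_sdiff ((Finset.range (c.length - 3)).image p)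
      (edgeNeighbors B S₁ (p (c.length - 3)))
    rw [Finset.card_range] at h2
    rw [← hN] at h4
    omega
  have hNw : ∀ w ∈ N, w ∈ S₁ ∧ w ∈ X ∧ s(p (c.length - 3), w) ∈ B ∧
      ∀ i ≤ c.length - 3, p i ≠ w := by
    intro w hw
    obtain ⟨h1, h2⟩ := Finset.mem_sdiff.1 hw
    obtain ⟨hwS, hwB⟩ := mem_edgeNeighbors.1 h1
    refine ⟨hwS, ?_, hwB, fun i hi h => ?_⟩
    · have := hbip _ _ hwB
      tauto
    rcases hi.lt_or_eq with hi | rfl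
    · exact h2 (Finset.mem_image.2 ⟨i, Finset.mem_range.2 hi, h⟩)
    · exact hB _ hwB (by simpa using h)
  have hzS₁ : z ∉ S₁ := fun h => (hS₁S z h).2 (Finset.mem_insert_self _ _)
  have hcopy : ∀ w ∈ N, H ⊑ fromEdgeSet
      ((insert s(z, x₀) (insert s(z, w) A) : Finset (Sym2 V)) : Set (Sym2 V)) := by
    intro w hw
    obtain ⟨hwS, hwX, hwB, hwp⟩ := hNw w hw
    have hwz : w ≠ z := ne_of_mem_of_not_mem hwS hzS₁
    set q : ℕ → V := fun i => if i ≤ c.length - 3 then p i else if i = c.length - 2 then w else z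
      with hq
    have hq1 : ∀ i ≤ c.length - 3, q i = p i := fun i hi => by simp [hq, hi]
    have hq2 : q (c.length - 2) = w := by
      simp only [hq]
      rw [if_neg (by omega), if_pos trivial]
    have hq3 : q (c.length - 1) = z := by
      simp only [hq]
      rw [if_neg (by omega), if_neg (by omega)]
    have hcase : ∀ i < c.length, i ≤ c.length - 3 ∨ i = c.length - 2 ∨ i = c.length - 1 := by omega
    have hpz : ∀ i ≤ c.length - 3, p i ≠ z := fun i hi =>
      ne_of_mem_of_not_mem (hpS i hi) hzS₁
    -- The copy is completed in `S` rather than `S₁`: the vertex `z` of the cycle is not in `S₁`,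
    -- but has large degree in `S`.
    refine hH.isContained_fromEdgeSet hc hB (B' := insert s(z, x₀) (insert s(z, w) A)) (S := S)
      (p := q) (hBA.trans ((Finset.subset_insert _ _).trans (Finset.subset_insert _ _)))
      hS ?_ ?_ ?_ ?_
    · intro i hi
      rcases hcase i hi with hi | rfl | rfl
      · rw [hq1 i hi]
        exact (hS₁S _ (hpS i hi)).1
      · rw [hq2]
        exact (hS₁S _ hwS).1
      · rw [hq3]
        exact hzS
    · intro i hi j hj he
      rcases hcase i hi with hi | rfl | rfl <;> rcases hcase j hj with hj | rfl | rfl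
      · rw [hq1 i hi, hq1 j hj] at he
        exact hinj i hi j hj he
      · rw [hq1 i hi, hq2] at he
        exact absurd he (hwp i hi)
      · rw [hq1 i hi, hq3] at he
        exact absurd he (hpz i hi)
      · rw [hq1 j hj, hq2] at he
        exact absurd he.symm (hwp j hj)
      · rfl
      · rw [hq2, hq3] at he
        exact absurd he hwz
      · rw [hq1 j hj, hq3] at he
        exact absurd he.symm (hpz j hj)
      · rw [hq2, hq3] at he
        exact absurd he.symm hwz
      · rfl
    · intro i hi
      rcases (show i + 1 ≤ c.length - 3 ∨ i = c.length - 3 ∨ i = c.length - 2 by omega) with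
        h | rfl | rfl
      · rw [hq1 i (by omega), hq1 _ h]
        exact Finset.mem_insert_of_mem (Finset.mem_insert_of_mem (hBA (hadj i (by omega))))
      · rw [hq1 _ le_rfl, show c.length - 3 + 1 = c.length - 2 by omega, hq2]
        exact Finset.mem_insert_of_mem (Finset.mem_insert_of_mem (hBA hwB))
      · rw [hq2, show c.length - 2 + 1 = c.length - 1 by omega, hq3, Sym2.eq_swap (a := w) (b := z)]
        exact Finset.mem_insert_of_mem (Finset.mem_insert_self _ _)
    · rw [hq3, hq1 0 (by omega), hp0]
      exact Finset.mem_insert_self _ _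
  obtain ⟨x₁, hx₁, x₂, hx₂, hne⟩ := Finset.one_lt_card.1 hNc
  have hmem : ∀ w ∈ S₁, w ∈ X → w ∈ X ∧ w ≠ z ∧ s(z, w) ∉ U := by
    refine fun w hw hwX => ⟨hwX, ne_of_mem_of_not_mem hw hzS₁, fun h => ?_⟩
    exact (hS₁S w hw).2 (Finset.mem_insert_of_mem (mem_edgeNeighbors.2
      ⟨Finset.mem_inter.2 ⟨(hS₁S w hw).1, hwX⟩, h⟩))
  refine ⟨z, hzX, ![x₀, x₁, x₂], ?_, ?_, ?_⟩
  · have h1 := (hNw x₁ hx₁).2.2.2 0 (by omega)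
    have h2 := (hNw x₂ hx₂).2.2.2 0 (by omega)
    rw [hp0] at h1 h2
    exact injective_vec3 h1 h2 hne
  · intro i
    fin_cases i
    · exact hmem _ hx₀ hx₀X
    · exact hmem _ (hNw x₁ hx₁).1 (hNw x₁ hx₁).2.1
    · exact hmem _ (hNw x₂ hx₂).1 (hNw x₂ hx₂).2.1
  · intro i hi
    fin_cases i
    · exact absurd rfl hi
    · exact hcopy _ hx₁
    · exact hcopy _ hx₂

end EdgeSets

/-! ### The game on the complete graph -/

section Main

open SimpleGraph

/-- Triples with disjoint sets of elements can be chosen one after the other. -/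
theorem exists_disjoint_triples {α : Type*} [DecidableEq α] (P : (Fin 3 → α) → Prop)
    (U₀ : Finset α) (M : ℕ)
    (hstep : ∀ U : Finset α, U₀ ⊆ U → U.card ≤ U₀.card + 3 * M →
      ∃ y : Fin 3 → α, Function.Injective y ∧ (∀ i, y i ∉ U) ∧ P y) :
    ∃ x : Fin M → Fin 3 → α, (Function.Injective fun a : Fin M × Fin 3 => x a.1 a.2) ∧
      ∀ j, P (x j) ∧ ∀ i, x j i ∉ U₀ := by
  have key : ∀ m ≤ M, ∃ x : Fin m → Fin 3 → α,
      (Function.Injective fun a : Fin m × Fin 3 => x a.1 a.2) ∧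
      ∀ j, P (x j) ∧ ∀ i, x j i ∉ U₀ := by
    intro m
    induction m with
    | zero =>
      exact fun _ => ⟨fun j => j.elim0, fun a => a.1.elim0, fun j => j.elim0⟩
    | succ m ih =>
      intro hm
      obtain ⟨x, hx, hxP⟩ := ih (by omega)
      obtain ⟨y, hy, hyU, hyP⟩ := hstep
        (U₀ ∪ Finset.univ.image fun a : Fin m × Fin 3 => x a.1 a.2) Finset.subset_union_left (by
          refine (Finset.card_union_le _ _).trans (Nat.add_le_add_left ?_ _)
          refine Finset.card_image_le.trans ?_
          simp only [Finset.card_univ, Fintype.card_prod, Fintype.card_fin]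
          omega)
      have hne : ∀ i j i', x j i' ≠ y i := fun i j i' h => hyU i (Finset.mem_union_right _
        (Finset.mem_image.2 ⟨(j, i'), Finset.mem_univ _, h⟩))
      refine ⟨Fin.cons y x, ?_, ?_⟩
      · rintro ⟨j, i⟩ ⟨j', i'⟩ h
        induction j using Fin.cases with
        | zero =>
          induction j' using Fin.cases with
          | zero =>
            have : i = i' := hy (by simpa using h)
            rw [this]
          | succ j' => exact absurd (by simpa using h.symm) (hne i j' i')
        | succ j =>
          induction j' using Fin.cases with
          | zero => exact absurd (by simpa using h) (hne i' j i)
          | succ j' =>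
            have : (j, i) = (j', i') := hx (by simpa using h)
            rw [Prod.mk.injEq] at this
            rw [this.1, this.2]
      · intro j
        induction j using Fin.cases with
        | zero => exact ⟨hyP, fun i h => hyU i (Finset.mem_union_left _ h)⟩
        | succ j => exact hxP j
  exact key M le_rfl

namespace AvoiderEnforcer

variable {W : Type*} [Fintype W] {H : SimpleGraph W}

theorem monotone_isContained_fromEdgeSet {W V : Type*} (H : SimpleGraph W) :
    Monotone fun A : Finset (Sym2 V) => H ⊑ fromEdgeSet (A : Set (Sym2 V)) :=
  fun _ _ hAB hA => hA.mono_right (fromEdgeSet_mono (Finset.coe_subset.2 hAB))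

variable {n : ℕ}

theorem mem_board {e : Sym2 (Fin n)} :
    e ∈ (⊤ : SimpleGraph (Fin n)).edgeFinset ↔ ¬ e.IsDiag := by
  rw [mem_edgeFinset, edgeSet_top]
  rfl

/-- The pairs inside `X`. -/
def innerPairs (X : Finset (Fin n)) : Finset (Sym2 (Fin n)) :=
  (⊤ : SimpleGraph (Fin n)).edgeFinset.filter fun e => e ∈ X.sym2

theorem mem_innerPairs {X : Finset (Fin n)} {e : Sym2 (Fin n)} :
    e ∈ innerPairs X ↔ ¬ e.IsDiag ∧ e ∈ X.sym2 := by
  rw [innerPairs, Finset.mem_filter, mem_board]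

/-- The pairs that join `x` to `Y`. -/
def starPairs (Y : Finset (Fin n)) (x : Fin n) : Finset (Sym2 (Fin n)) :=
  Y.image fun y => s(x, y)

theorem mem_starPairs {X Y : Finset (Fin n)} (hXY : Disjoint X Y) {x u v : Fin n} (hx : x ∈ X)
    (hu : u ∈ X) : s(u, v) ∈ starPairs Y x ↔ u = x ∧ v ∈ Y := by
  simp only [starPairs, Finset.mem_image, Sym2.eq_iff]
  constructor
  · rintro ⟨y, hy, ⟨rfl, rfl⟩ | ⟨rfl, rfl⟩⟩
    · exact ⟨rfl, hy⟩
    · exact absurd hy (Finset.disjoint_left.1 hXY hu)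
  · rintro ⟨rfl, hv⟩
    exact ⟨v, hv, Or.inl ⟨rfl, rfl⟩⟩

variable {b : ℕ} {v₀ : W} {c : H.Walk v₀ v₀}

/-- The first `|W| * |X|` pairs pay the error term of `IsUnicyclic.exists_threats`; the other `b +
1` leave more than `b` threats, all free because Enforcer has nothing inside `X`. -/
theorem EnforcerWins.of_inner_edges (hH : IsUnicyclic H) (hc : c.IsCycle) (X : Finset (Fin n))
    (p : Position (Sym2 (Fin n))) (hA : p.avoider ⊆ (⊤ : SimpleGraph (Fin n)).edgeFinset)
    (hE : Disjoint p.enforcer (innerPairs X))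
    (hcard : Fintype.card W * X.card + (b + 1) ≤ (p.avoider ∩ innerPairs X).card) :
    EnforcerWins (⊤ : SimpleGraph (Fin n)).edgeFinset b
      (fun A => H ⊑ fromEdgeSet (A : Set (Sym2 (Fin n)))) p := by
  have hmono := monotone_isContained_fromEdgeSet (V := Fin n) H
  rcases hH.exists_threats hc (B := p.avoider) (fun e he => mem_board.1 (hA he)) X with h | h
  · exact of_losing hmono p h
  · obtain ⟨Θ, hΘX, hΘ, hΘc⟩ := h
    have h1 : p.avoider ∩ innerPairs X ⊆ edgesWithin p.avoider X := fun e he =>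
      Finset.mem_filter.2 ⟨(Finset.mem_inter.1 he).1,
        (mem_innerPairs.1 (Finset.mem_inter.1 he).2).2⟩
    have h2 := Finset.card_le_card h1
    refine of_threats hmono p Θ (fun f hf => ?_) (fun f hf => (hΘ f hf).2.2)
      (Finset.card_pos.1 (by omega)) (Or.inl (by omega))
    refine Finset.mem_sdiff.2 ⟨mem_board.2 (hΘ f hf).1, fun h => ?_⟩
    rcases Finset.mem_union.1 h with h | h
    · exact (hΘ f hf).2.1 h
    · exact Finset.disjoint_left.1 hE h (mem_innerPairs.2 ⟨(hΘ f hf).1, hΘX hf⟩)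

/-- The core of Avoider's star edges is so dense that `IsUnicyclic.exists_triple` can be repeated,
avoiding the claimed pairs inside `X` and the triples already chosen, until there are enough triples
for `EnforcerWins.of_pieces`. -/
theorem EnforcerWins.of_star_edges (hH : IsUnicyclic H) (hc : c.IsCycle) (heven : Even c.length)
    {X Y : Finset (Fin n)} (hXY : Disjoint X Y)
    (hX : X.card = 100 * Fintype.card W * (b + 1)) (hY : Y.card = 4 * Fintype.card W * (b + 1))
    (p : Position (Sym2 (Fin n)))
    (hE : (p.enforcer ∩ innerPairs X).card ≤ b)
    (hA : (p.avoider ∩ innerPairs X).card ≤ Fintype.card W * X.card + (b + 1))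
    (hrow : ∀ x : X, (p.avoider ∩ starPairs Y x).card ≤ 4 * Fintype.card W)
    (hsum : 4 * Fintype.card W * Fintype.card X ≤ ∑ x : X, (p.avoider ∩ starPairs Y x).card +
      (Fintype.card W * X.card + (b + 1)) + 1) :
    EnforcerWins (⊤ : SimpleGraph (Fin n)).edgeFinset b
      (fun A => H ⊑ fromEdgeSet (A : Set (Sym2 (Fin n)))) p := by
  have hk := IsCycle.length_le_card hc
  have h3 := hc.three_le_length
  have h4 : 4 ≤ Fintype.card W := by
    obtain ⟨r, hr⟩ := heven
    omega
  set h := Fintype.card W with hh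
  set B : Finset (Sym2 (Fin n)) := Finset.univ.biUnion fun x : X => p.avoider ∩ starPairs Y x
    with hB
  have hmemB : ∀ u v, s(u, v) ∈ B → (u ∈ X ∧ v ∈ Y) ∨ (v ∈ X ∧ u ∈ Y) := by
    intro u v huv
    obtain ⟨x, -, hx⟩ := Finset.mem_biUnion.1 huv
    obtain ⟨y, hy, hxy⟩ := Finset.mem_image.1 (Finset.mem_inter.1 hx).2
    rcases Sym2.eq_iff.1 hxy with ⟨rfl, rfl⟩ | ⟨rfl, rfl⟩
    · exact Or.inl ⟨x.2, hy⟩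
    · exact Or.inr ⟨x.2, hy⟩
  have hbip : ∀ u v, s(u, v) ∈ B → (u ∈ X ↔ v ∉ X) := by
    intro u v huv
    have h2 : u ∈ X → u ∉ Y := fun hu => Finset.disjoint_left.1 hXY hu
    have h5 : v ∈ X → v ∉ Y := fun hv => Finset.disjoint_left.1 hXY hv
    have := hmemB u v huv
    tauto
  have hBA : B ⊆ p.avoider := Finset.biUnion_subset.2 fun x _ => Finset.inter_subset_left
  have hBc : B.card = ∑ x : X, (p.avoider ∩ starPairs Y x).card := by
    refine Finset.card_biUnion fun x _ x' _ hne => ?_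
    refine Finset.disjoint_left.2 fun e he he' => hne ?_
    obtain ⟨y, hy, rfl⟩ := Finset.mem_image.1 (Finset.mem_inter.1 he).2
    exact Subtype.ext ((mem_starPairs hXY x'.2 x.2).1 (Finset.mem_inter.1 he').2).1
  have hBw : edgesWithin B (X ∪ Y) = B := by
    refine Finset.filter_true_of_mem fun e he => ?_
    induction e with
    | _ u v =>
      rw [Finset.mk_mem_sym2_iff, Finset.mem_union, Finset.mem_union]
      have := hmemB u v he
      tauto
  obtain ⟨S, hS, hdeg, hSc⟩ := exists_core B h (X ∪ Y)
  have hD : ∀ v ∈ X, (edgeNeighbors B S v).card ≤ 4 * h := by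
    intro v hv
    refine le_trans ?_ (hrow ⟨v, hv⟩)
    rw [← Finset.card_image_of_injective _
      (fun a b hab => Sym2.congr_right.1 hab : Function.Injective fun w => s(v, w))]
    refine Finset.card_le_card fun e he => ?_
    obtain ⟨w, hw, rfl⟩ := Finset.mem_image.1 he
    obtain ⟨x, -, hx⟩ := Finset.mem_biUnion.1 (mem_edgeNeighbors.1 hw).2
    obtain ⟨h1, h2⟩ := Finset.mem_inter.1 hx
    obtain ⟨rfl, -⟩ := (mem_starPairs hXY x.2 hv).1 h2
    exact hx
  have hSX : (edgesWithin B S).card ≤ (S ∩ X).card * (4 * h) := by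
    have h1 := card_edgesWithin_sdiff_le B S (S ∩ X)
    have h2 : ∑ v ∈ S ∩ X, (edgeNeighbors B S v).card ≤ (S ∩ X).card * (4 * h) :=
      Finset.sum_le_card_nsmul _ _ _ fun v hv => hD v (Finset.mem_inter.1 hv).2
    have h5 : (edgesWithin B (S \ (S ∩ X))).card = 0 := by
      rw [Finset.card_eq_zero]
      refine Finset.eq_empty_of_forall_notMem fun e he => ?_
      obtain ⟨heB, heS⟩ := Finset.mem_filter.1 he
      induction e with
      | _ u v =>
        rw [Finset.mk_mem_sym2_iff] at heS
        have := hbip u v heB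
        simp only [Finset.mem_sdiff, Finset.mem_inter] at heS
        tauto
    omega
  have hXYc : (X ∪ Y).card = 104 * h * (b + 1) := by
    rw [Finset.card_union_of_disjoint hXY, hX, hY]
    ring
  rw [hBw, hBc, hXYc] at hSc
  rw [Fintype.card_coe, hX] at hsum
  rw [hX] at hA
  -- In units of `h²(b + 1)`: of `400`, the pairs inside `X` cost `100` and the passage to the core
  -- `104`; the slack from `196` to `190` absorbs `b + 2`.
  have hbase : 190 * (h * h * (b + 1)) + h * S.card ≤ (edgesWithin B S).card := by
    have h16 : 4 * 4 * (b + 1) ≤ h * h * (b + 1) :=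
      Nat.mul_le_mul_right _ (Nat.mul_le_mul h4 h4)
    linarith
  -- Each edge of the core has an end in `S ∩ X`, where degrees are at most `4h`.
  have ha : 95 * (h * (b + 1)) ≤ 2 * (S ∩ X).card := by
    refine Nat.le_of_mul_le_mul_left (c := 2 * h) ?_ (by omega)
    linarith [Nat.zero_le (h * S.card)]
  obtain ⟨x, hx, hxP⟩ := exists_disjoint_triples (fun y : Fin 3 → Sym2 (Fin n) =>
    (∀ i, y i ∈ innerPairs X) ∧ ∀ i, i ≠ 0 → H ⊑ fromEdgeSet
      ((insert (y 0) (insert (y i) p.avoider) : Finset (Sym2 (Fin n))) : Set (Sym2 (Fin n))))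
    (p.avoider ∩ innerPairs X ∪ p.enforcer ∩ innerPairs X) ((b + 1) * (b + 3)) (by
      intro U hU hUc
      have hU0 := Finset.card_union_le (p.avoider ∩ innerPairs X) (p.enforcer ∩ innerPairs X)
      -- In `β`, the term `5h` pays for the claimed pairs, of order `h²(b + 1)`, and `b` for the
      -- chosen triples, of order `(b + 1)²`.
      obtain ⟨z, hz, x, hxinj, hxm, hxc⟩ := hH.exists_triple hc heven (A := p.avoider) (B := B)
        (U := U) hBA (X := X) (S := S) hbip hdeg (D := 4 * h) (β := b + 5 * h) hD
        (by
          have hUb : U.card ≤ 100 * (h * h * (b + 1)) + 2 * (b + 1) +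
              3 * ((b + 1) * (b + 3)) := by linarith
          have h5 : (b + 5 * h + 1) * (95 * (h * (b + 1))) ≤
              (b + 5 * h + 1) * (2 * (S ∩ X).card) := Nat.mul_le_mul_left _ ha
          have h6 : 4 * ((b + 1) * (b + 1)) ≤ h * ((b + 1) * (b + 1)) :=
            Nat.mul_le_mul_right _ h4
          have h16 : 4 * 4 * (b + 1) ≤ h * h * (b + 1) :=
            Nat.mul_le_mul_right _ (Nat.mul_le_mul h4 h4)
          have h7 : 0 ≤ b * b := Nat.zero_le _
          linarith)
        (by
          have h5 : h * h * 1 ≤ h * h * (b + 1) := Nat.mul_le_mul_left _ (by omega)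
          have h6 : 4 * (h * (b + 1)) ≤ h * (h * (b + 1)) := Nat.mul_le_mul_right _ h4
          have h7 : 0 < h * h * (b + 1) := by positivity
          linarith)
      refine ⟨fun i => s(z, x i), fun i j hij => hxinj (Sym2.congr_right.1 hij),
        fun i => (hxm i).2.2, fun i => ?_, hxc⟩
      refine mem_innerPairs.2 ⟨fun hd => (hxm i).2.1 ?_,
        Finset.mk_mem_sym2_iff.2 ⟨hz, (hxm i).1⟩⟩
      exact (by simpa using hd : z = x i).symm)
  refine of_pieces (monotone_isContained_fromEdgeSet (V := Fin n) H) p x hx (fun j i => ?_)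
    (fun j => (hxP j).1.2 1 (by decide)) (fun j => (hxP j).1.2 2 (by decide)) (by simp)
  have h1 := (hxP j).1.1 i
  have h2 := (hxP j).2 i
  refine Finset.mem_sdiff.2 ⟨mem_board.2 (mem_innerPairs.1 h1).1, fun h5 => h2 ?_⟩
  rw [← Finset.union_inter_distrib_right]
  exact Finset.mem_inter.2 ⟨h5, h1⟩

theorem enforcerWinsGraphGame (hH : IsUnicyclic H) (hc : c.IsCycle) (heven : Even c.length)
    (hn : 200 * Fintype.card W * (b + 1) ≤ n) : EnforcerWinsGraphGame H n b := by
  obtain ⟨X, -, hX⟩ := Finset.exists_subset_card_eq (s := (Finset.univ : Finset (Fin n)))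
    (n := 100 * Fintype.card W * (b + 1)) (by rw [Finset.card_univ, Fintype.card_fin]; nlinarith)
  obtain ⟨Y, hYX, hY⟩ := Finset.exists_subset_card_eq (s := Xᶜ)
    (n := 4 * Fintype.card W * (b + 1))
    (by rw [Finset.card_compl, hX, Fintype.card_fin]; apply Nat.le_sub_of_add_le; nlinarith)
  have hXY : Disjoint X Y := Finset.disjoint_right.2 fun v hv => Finset.mem_compl.1 (hYX hv)
  refine EnforcerWins.exists_strategy (EnforcerWins.of_rows (ι := X)
    (row := fun x => starPairs Y x) (Sp := innerPairs X) (D := 4 * Fintype.card W) ?_ ?_ ?_ ?_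
    (Fintype.card W * X.card + (b + 1))
    (fun p h1 h2 h3 => EnforcerWins.of_inner_edges hH hc X p h1 h2 h3)
    (fun p _ h2 h3 h4 h5 => EnforcerWins.of_star_edges hH hc heven hXY hX hY p h2 h3 h4 h5))
  · intro x e he
    obtain ⟨y, hy, rfl⟩ := Finset.mem_image.1 he
    refine mem_board.2 fun hd => Finset.disjoint_left.1 hXY x.2 ?_
    rwa [(by simpa using hd : (x : Fin n) = y)]
  · intro x x' hne
    refine Finset.disjoint_left.2 fun e he he' => hne ?_
    obtain ⟨y, hy, rfl⟩ := Finset.mem_image.1 he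
    exact Subtype.ext ((mem_starPairs hXY x'.2 x.2).1 he').1
  · intro x
    refine Finset.disjoint_left.2 fun e he he' => ?_
    obtain ⟨y, hy, rfl⟩ := Finset.mem_image.1 he
    exact Finset.disjoint_right.1 hXY hy
      (Finset.mk_mem_sym2_iff.1 (mem_innerPairs.1 he').2).2
  · intro x
    rw [starPairs, Finset.card_image_of_injective _ fun a b hab => Sym2.congr_right.1 hab, hY]

end AvoiderEnforcer

end Main

theorem mainTheorem8 {W : Type*} [Fintype W] (H : SimpleGraph W) (hH : IsUnicyclic H)
    (h k : ℕ) (hh : Fintype.card W = h)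
    (hk : ∃ (v : W) (c : H.Walk v v), c.IsCycle ∧ c.length = k) (hk_even : Even k)
    (n b : ℕ) (hb : (b : ℝ) + 1 ≤ (n : ℝ) / (200 * (k : ℝ) * ((h : ℝ) - (k : ℝ) + 1))) :
    AvoiderEnforcer.EnforcerWinsGraphGame H n b := by
  obtain ⟨v, c, hc, rfl⟩ := hk
  have h3 := hc.three_le_length
  have hkh := IsCycle.length_le_card hc
  rw [hh] at hkh
  refine AvoiderEnforcer.enforcerWinsGraphGame hH hc hk_even ?_
  rw [hh]
  have h3' : (3 : ℝ) ≤ c.length := by exact_mod_cast h3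
  have hkh' : (c.length : ℝ) ≤ h := by exact_mod_cast hkh
  have hpos : 0 < 200 * (c.length : ℝ) * ((h : ℝ) - c.length + 1) :=
    mul_pos (by linarith) (by linarith)
  rw [le_div_iff₀ hpos] at hb
  -- The difference of the two sides is `(k - 1)(h - k)`.
  have h1 : (h : ℝ) ≤ c.length * ((h : ℝ) - c.length + 1) := by nlinarith
  have h2 : (200 : ℝ) * h * (b + 1) ≤ n := by
    refine le_trans ?_ hb
    nlinarith [mul_le_mul_of_nonneg_left h1 (by positivity : (0 : ℝ) ≤ b + 1)]
  exact_mod_cast h2
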